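/- Let $k$ be a field of characteristic zero, let $Q$ be the quiver with one vertex $e$ and one loop $a$, and let $A = kQ/\langle Q_2\rangle$ be the quotient of its path algebra by the two-sided ideal generated by the paths of length two, so that $A$ has the $k$-basis $e = 1, a$ with $a^2 = 0$. Let $HH^{odd} = \bigoplus_{n \text{ odd}} HH^n(A)$, where $HH^n(A)$ is the $n$-th Hochschild cohomology of $A$, computed by the Hochschild complex $C^n(A,A) = \mathrm{Hom}_k(A^{\otimes n}, A)$. For $n \ge 1$ let $(a^n,a) \in C^n(A,A)$ be the cochain $x_1 \otimes \cdots \otimes x_n \mapsto c(x_1)\cdots c(x_n)\,a$, where $c(x)$ denotes the coefficient of $a$ in $x$. The Gerstenhaber bracket of cochains induces a well-defined bilinear bracket $[\,,\,]$ on $HH^{odd}$, which makes $HH^{odd}$ a Lie algebra over $k$. For every odd $n$ the cochain $(a^n,a)$ is a cocycle, the classes of the $(a^n,a)$, $n = 1, 3, 5, \dots$, form a $k$-basis of $HH^{odd}$, and for all odd $n, m$ $$[(a^n,a),(a^m,a)] = (n-m)\,(a^{n+m-1},a).$$ Consequently $HH^{odd}$ is the non-negative part of the infinite-dimensional Witt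 algebra: if $L_i = -T^{i+1}\frac{d}{dT}$ $(i \in \mathbb{Z})$ denote the standard basis elements of the Witt algebra $\mathrm{Der}_k\, k[T,T^{-1}]$, with $[L_i,L_j] = (i-j)L_{i+j}$, then $(a^{2i+1},a) \mapsto 2L_i$ $(i \ge 0)$ defines an isomorphism of Lie algebras from $HH^{odd}$ onto the Lie subalgebra of the Witt algebra with basis $(L_i)_{i\ge 0}$. -/

import Mathlib

open scoped DirectSum

noncomputable section

namespace Hochschild

/-! ## Hochschild cochains and the Gerstenhaber bracket of an associative algebra -/

/-- The space `C^n(A,A) = Hom_k(A^{⊗n}, A)` of Hochschild `n`-cochains, as `k`-multilinear maps. -/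
abbrev Cochain (k A : Type*) [CommRing k] [Ring A] [Algebra k A] (n : ℕ) :=
  MultilinearMap k (fun _ : Fin n => A) A

section Subquotient

variable {R M : Type*} [Ring R] [AddCommGroup M] [Module R M]

/-- The quotient `Z / B` of a submodule `Z` by a submodule `B` (in fact by `Z ∩ B`). -/
def Subquotient (Z B : Submodule R M) := Z ⧸ B.submoduleOf Z

instance (Z B : Submodule R M) : AddCommGroup (Subquotient Z B) :=
  inferInstanceAs (AddCommGroup (Z ⧸ B.submoduleOf Z))

instance (Z B : Submodule R M) : Module R (Subquotient Z B) :=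
  inferInstanceAs (Module R (Z ⧸ B.submoduleOf Z))

/-- The projection `Z → Z / B`. -/
def Subquotient.mk (Z B : Submodule R M) : Z →ₗ[R] Subquotient Z B := (B.submoduleOf Z).mkQ

end Subquotient

section Args

variable {A : Type*}

/-- The `n` arguments `(x₁, …, x_{i-1}, g(x_i, …, x_{i+m-1}), x_{i+m}, …, x_N)` where
`N = n + m - 1`; indices in the code start from `0`. -/
def circArgs {n m N : ℕ} (h : N + 1 = n + m) (i : Fin n) (g : (Fin m → A) → A)
    (x : Fin N → A) : Fin n → A := fun l =>
  if hl : (l : ℕ) < i then x ⟨l, by omega⟩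
  else if hi : (l : ℕ) = i then g (fun t => x ⟨i + t, by omega⟩)
  else x ⟨l - 1 + m, by omega⟩

theorem circArgs_eq_update {n m N : ℕ} (h : N + 1 = n + m) (i : Fin n)
    (g g' : (Fin m → A) → A) (x : Fin N → A) :
    circArgs h i g x =
      Function.update (circArgs h i g' x) i (g (fun t => x ⟨i + t, by omega⟩)) := by
  funext l
  by_cases hl : l = i
  · subst hl
    simp [circArgs]
  · have : (l : ℕ) ≠ i := fun h' => hl (Fin.ext h')
    simp [circArgs, Function.update_of_ne hl, this]

/-- Updating one argument of `x` updates a single argument in `circArgs`: either inside the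
block that is fed into `g`, or outside of it. -/
theorem circArgs_update {n m N : ℕ} [DecidableEq (Fin N)] (h : N + 1 = n + m) (i : Fin n)
    (g : (Fin m → A) → A) (x : Fin N → A) (s : Fin N) :
    (∃ t : Fin m, ∀ v, circArgs h i g (Function.update x s v) =
      Function.update (circArgs h i g x) i
        (g (Function.update (fun t => x ⟨i + t, by omega⟩) t v))) ∨
    (∃ l : Fin n, ∀ v, circArgs h i g (Function.update x s v) =
      Function.update (circArgs h i g x) l v) := by
  have key : ∀ (v : A) (j : ℕ) (hj : j < N),
      Function.update x s v ⟨j, hj⟩ = if j = s then v else x ⟨j, hj⟩ := by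
    intro v j hj
    simp [Function.update_apply, Fin.ext_iff]
  by_cases h1 : (s : ℕ) < i
  · right
    refine ⟨⟨s, by omega⟩, fun v => ?_⟩
    funext l
    simp only [circArgs, key, Function.update_apply, Fin.ext_iff]
    by_cases hl : (l : ℕ) < i
    · simp [hl]
    · by_cases hi : (l : ℕ) = i
      · have e1 : ¬ ((l : ℕ) = s) := by omega
        have e2 : ∀ t : Fin m, ¬ ((i : ℕ) + t = s) := fun t => by omega
        have e3 : ¬ ((i : ℕ) = s) := by omega
        simp [hi, e2, e3]
      · have e1 : ¬ ((l : ℕ) = s) := by omega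
        have e2 : ¬ ((l : ℕ) - 1 + m = s) := by omega
        simp [hl, hi, e1, e2]
  · by_cases h2 : (s : ℕ) < i + m
    · left
      refine ⟨⟨s - i, by omega⟩, fun v => ?_⟩
      funext l
      simp only [circArgs, key, Function.update_apply, Fin.ext_iff]
      by_cases hl : (l : ℕ) < i
      · have e1 : ¬ ((l : ℕ) = s) := by omega
        have e2 : ¬ ((l : ℕ) = i) := by omega
        simp [hl, e1, e2]
      · by_cases hi : (l : ℕ) = i
        · simp only [hi, lt_irrefl, dite_false, dite_true, if_true]
          congr 1
          funext t
          have e2 : ((i : ℕ) + t = s) ↔ ((t : ℕ) = s - i) := by omega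
          simp [Function.update_apply, Fin.ext_iff, e2]
        · have e1 : ¬ ((l : ℕ) - 1 + m = s) := by omega
          simp [hl, hi, e1]
    · right
      refine ⟨⟨s + 1 - m, by omega⟩, fun v => ?_⟩
      funext l
      simp only [circArgs, key, Function.update_apply, Fin.ext_iff]
      by_cases hl : (l : ℕ) < i
      · have e1 : ¬ ((l : ℕ) = s) := by omega
        have e2 : ¬ ((l : ℕ) = s + 1 - m) := by omega
        simp [hl, e1, e2]
      · by_cases hi : (l : ℕ) = i
        · have e1 : ¬ ((i : ℕ) = s + 1 - m) := by omega
          have e2 : ∀ t : Fin m, ¬ ((i : ℕ) + t = s) := fun t => by omega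
          simp [hi, e1, e2]
        · have e1 : ((l : ℕ) - 1 + m = s) ↔ ((l : ℕ) = s + 1 - m) := by omega
          simp [hl, hi, e1]

end Args

section General

variable {k A : Type*} [CommRing k] [Ring A] [Algebra k A]

/-- The partial composition `f ∘_i g : C^n × C^m → C^{n+m-1}`,
`(f ∘_i g)(x₁,…,x_{n+m-1}) = f(x₁,…,g(x_i,…,x_{i+m-1}),…,x_{n+m-1})`. The degree `n + m - 1` of the
result is a variable `N` with `N + 1 = n + m`. -/
def circ {n m N : ℕ} (h : N + 1 = n + m) (i : Fin n) (f : Cochain k A n) (g : Cochain k A m) :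
    Cochain k A N where
  toFun x := f (circArgs h i g x)
  map_update_add' x s v w := by
    rcases circArgs_update h i (⇑g) x s with ⟨t, ht⟩ | ⟨l, hl⟩
    · simp only [ht, MultilinearMap.map_update_add]
    · simp only [hl, MultilinearMap.map_update_add]
  map_update_smul' x s c v := by
    rcases circArgs_update h i (⇑g) x s with ⟨t, ht⟩ | ⟨l, hl⟩
    · simp only [ht, MultilinearMap.map_update_smul]
    · simp only [hl, MultilinearMap.map_update_smul]

theorem circ_add_left {n m N : ℕ} (h : N + 1 = n + m) (i : Fin n) (f f' : Cochain k A n)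
    (g : Cochain k A m) : circ h i (f + f') g = circ h i f g + circ h i f' g := rfl

theorem circ_smul_left {n m N : ℕ} (h : N + 1 = n + m) (i : Fin n) (c : k) (f : Cochain k A n)
    (g : Cochain k A m) : circ h i (c • f) g = c • circ h i f g := rfl

theorem circ_add_right {n m N : ℕ} (h : N + 1 = n + m) (i : Fin n) (f : Cochain k A n)
    (g g' : Cochain k A m) : circ h i f (g + g') = circ h i f g + circ h i f g' := by
  ext x
  change f (circArgs h i (⇑(g + g')) x) = f (circArgs h i g x) + f (circArgs h i g' x)
  rw [circArgs_eq_update h i (⇑(g + g')) 0, circArgs_eq_update h i (⇑g) 0,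
    circArgs_eq_update h i (⇑g') 0, add_apply, MultilinearMap.map_update_add]

theorem circ_smul_right {n m N : ℕ} (h : N + 1 = n + m) (i : Fin n) (c : k) (f : Cochain k A n)
    (g : Cochain k A m) : circ h i f (c • g) = c • circ h i f g := by
  ext x
  change f (circArgs h i (⇑(c • g)) x) = c • f (circArgs h i g x)
  rw [circArgs_eq_update h i (⇑(c • g)) 0, circArgs_eq_update h i (⇑g) 0,
    smul_apply, MultilinearMap.map_update_smul]

/-- The operation `f ∘ g = ∑_{i=1}^n (-1)^{(i-1)(m-1)} f ∘_i g`. In the code `i` runs from `0`, and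
`m + 1` is written for `m - 1`, which has the same parity and avoids truncated subtraction. -/
def comp {n m N : ℕ} (h : N + 1 = n + m) (f : Cochain k A n) (g : Cochain k A m) :
    Cochain k A N :=
  ∑ i : Fin n, (-1 : k) ^ ((i : ℕ) * (m + 1)) • circ h i f g

/-- The Gerstenhaber bracket `[f, g] = f ∘ g - (-1)^{(n-1)(m-1)} g ∘ f` of `f ∈ C^n`, `g ∈ C^m`
(with `n + 1`, `m + 1` in place of `n - 1`, `m - 1` in the sign). -/
def gerstenhaber {n m N : ℕ} (h : N + 1 = n + m) (f : Cochain k A n) (g : Cochain k A m) :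
    Cochain k A N :=
  comp h f g - (-1 : k) ^ ((n + 1) * (m + 1)) • comp (h.trans (add_comm n m)) g f

variable (k A) in
/-- The multiplication of `A` as a 2-cochain. -/
def mulCochain : Cochain k A 2 where
  toFun x := x 0 * x 1
  map_update_add' x i v w := by
    fin_cases i <;> simp [add_mul, mul_add]
  map_update_smul' x i c v := by
    fin_cases i <;> simp

variable (k A) in
/-- The Hochschild differential `C^n → C^{n+1}`. The three summands are
`x₁ f(x₂,…,x_{n+1})`, `∑_{i=1}^n (-1)^i f(x₁,…,x_i x_{i+1},…,x_{n+1})` and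
`(-1)^{n+1} f(x₁,…,x_n) x_{n+1}`; see `differential_apply`. -/
def differential (n : ℕ) : Cochain k A n →ₗ[k] Cochain k A (n + 1) where
  toFun f :=
    circ (by omega) 1 (mulCochain k A) f
      + ∑ i : Fin n, (-1 : k) ^ ((i : ℕ) + 1) • circ (by omega) i f (mulCochain k A)
      + (-1 : k) ^ (n + 1) • circ (by omega) 0 (mulCochain k A) f
  map_add' f g := by
    simp only [circ_add_left, circ_add_right, smul_add, Finset.sum_add_distrib]
    abel
  map_smul' c f := by
    simp only [circ_smul_left, circ_smul_right, smul_add, Finset.smul_sum, RingHom.id_apply,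
      smul_comm c]

/-- The explicit formula for the Hochschild differential. -/
theorem differential_apply (n : ℕ) (f : Cochain k A n) (x : Fin (n + 1) → A) :
    differential k A n f x =
      x 0 * f (fun j => x j.succ)
        + ∑ i : Fin n, (-1 : k) ^ ((i : ℕ) + 1) • f (fun j =>
            if j < i then x j.castSucc
            else if j = i then x i.castSucc * x i.succ
            else x j.succ)
        + (-1 : k) ^ (n + 1) • (f (fun j => x j.castSucc) * x (Fin.last n)) := by
  have h1 : circ (by omega : n + 1 + 1 = 2 + n) (1 : Fin 2) (mulCochain k A) f x
      = x 0 * f (fun j => x j.succ) := by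
    change circArgs (by omega : n + 1 + 1 = 2 + n) _ (⇑f) x 0 * circArgs (by omega : n + 1 + 1 = 2 + n) _ (⇑f) x 1 = _
    have e : ∀ t : Fin n, (⟨1 + (t : ℕ), by omega⟩ : Fin (n + 1)) = t.succ := fun t =>
      Fin.ext (by simp [add_comm])
    simp [circArgs, e]
  have h3 : circ (by omega : n + 1 + 1 = 2 + n) (0 : Fin 2) (mulCochain k A) f x
      = f (fun j => x j.castSucc) * x (Fin.last n) := by
    change circArgs (by omega : n + 1 + 1 = 2 + n) _ (⇑f) x 0 * circArgs (by omega : n + 1 + 1 = 2 + n) _ (⇑f) x 1 = _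
    have e : ∀ t : Fin n, (⟨(t : ℕ), by omega⟩ : Fin (n + 1)) = t.castSucc := fun t => rfl
    have e' : (⟨n, by omega⟩ : Fin (n + 1)) = Fin.last n := rfl
    simp [circArgs, e, e']
  have h2 : ∀ i : Fin n, circ (by omega : n + 1 + 1 = n + 2) i f (mulCochain k A) x
      = f (fun j => if j < i then x j.castSucc
            else if j = i then x i.castSucc * x i.succ else x j.succ) := by
    intro i
    change f (circArgs _ _ _ _) = _
    congr 1
    funext j
    simp only [circArgs, Fin.lt_def, Fin.ext_iff]
    by_cases hl : (j : ℕ) < i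
    · simp only [hl, dite_true, if_true]; rfl
    · by_cases hi : (j : ℕ) = i
      · simp only [hi, lt_irrefl, dite_false, dite_true, if_true, if_false]; rfl
      · simp only [hl, hi, dite_false, if_false]
        congr 1
        exact Fin.ext (by simp; omega)
  simp only [differential, LinearMap.coe_mk, AddHom.coe_mk, add_apply,
    sum_apply, smul_apply, h1, h2, h3]

/-! ## Hochschild cohomology -/

variable (k A)

/-- Hochschild `n`-cocycles. -/
def cocycles (n : ℕ) : Submodule k (Cochain k A n) := LinearMap.ker (differential k A n)

/-- Hochschild `n`-coboundaries. -/
def coboundaries : (n : ℕ) → Submodule k (Cochain k A n)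
  | 0 => ⊥
  | n + 1 => LinearMap.range (differential k A n)

/-- The Hochschild cohomology group `HH^n(A)`: cocycles modulo coboundaries. -/
abbrev HH (n : ℕ) := Subquotient (cocycles k A n) (coboundaries k A n)

/-- `HH^{odd}(A) = ⨁_{n odd} HH^n(A)`. -/
abbrev HHOdd := ⨁ n : {n : ℕ // Odd n}, HH k A n

variable {k A}

/-- The class in `HH^{odd}(A)` of a cocycle of odd degree `n`. -/
def oddClass {n : ℕ} (hn : Odd n) (f : cocycles k A n) : HHOdd k A :=
  DirectSum.lof k {n : ℕ // Odd n} (fun n => HH k A n) ⟨n, hn⟩ (Subquotient.mk _ _ f)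

/-- `B` is the bracket on `HH^{odd}(A)` induced by the Gerstenhaber bracket: for cocycles `f`, `g`
of odd degrees the cochain `[f, g]` is a cocycle and `B` sends the classes of `f`, `g` to the class
of `[f, g]`. (At most one bilinear `B` has this property, as classes of cocycles span.) -/
def IsInducedBracket (B : HHOdd k A →ₗ[k] HHOdd k A →ₗ[k] HHOdd k A) : Prop :=
  ∀ (n m N : ℕ) (hn : Odd n) (hm : Odd m) (hN : Odd N) (h : N + 1 = n + m)
    (f : cocycles k A n) (g : cocycles k A m),
    ∃ hfg : gerstenhaber h (f : Cochain k A n) (g : Cochain k A m) ∈ cocycles k A N,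
      B (oddClass hn f) (oddClass hm g) = oddClass hN ⟨_, hfg⟩

end General

/-! ## The algebra `kQ / ⟨Q₂⟩` of the one-loop quiver -/

/-- The one-loop quiver: one vertex, and one arrow from it to itself. -/
abbrev LoopQuiver := Quiver.SingleObj Unit

/-- The unique vertex. -/
abbrev LoopQuiver.vertex : LoopQuiver := Quiver.SingleObj.star Unit

/-- The unique arrow. -/
def LoopQuiver.arrow : LoopQuiver.vertex ⟶ LoopQuiver.vertex := ()

/-- All paths of the one-loop quiver; they start and end at the unique vertex. -/
def LoopPath := Quiver.Path LoopQuiver.vertex LoopQuiver.vertex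

/-- The loop `a`, as a path of length one. -/
def LoopPath.loop : LoopPath := Quiver.Hom.toPath LoopQuiver.arrow

/-- The length of a path. -/
def LoopPath.length (p : LoopPath) : ℕ := Quiver.Path.length p

/-- As there is only one vertex, any two paths can be concatenated, and the trivial path is
neutral. -/
instance : Monoid LoopPath where
  mul p q := Quiver.Path.comp p q
  one := Quiver.Path.nil
  mul_assoc p q r := Quiver.Path.comp_assoc p q r
  one_mul p := Quiver.Path.nil_comp p
  mul_one p := Quiver.Path.comp_nil p

variable (k : Type*) [Field k]

/-- The path algebra `kQ`: the `k`-linear span of all paths, multiplied by concatenation. -/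
abbrev PathAlg := MonoidAlgebra k LoopPath

/-- The two-sided ideal `⟨Q₂⟩` generated by the paths of length two. -/
def lengthTwoIdeal : TwoSidedIdeal (PathAlg k) :=
  TwoSidedIdeal.span {x | ∃ p : LoopPath, p.length = 2 ∧ x = MonoidAlgebra.of k LoopPath p}

/-- The algebra `A = kQ / ⟨Q₂⟩`. -/
abbrev LoopAlg := (lengthTwoIdeal k).ringCon.Quotient

/-- The image in `A` of a path. -/
def LoopAlg.ofPath (p : LoopPath) : LoopAlg k :=
  (lengthTwoIdeal k).ringCon.mk' (MonoidAlgebra.of k LoopPath p)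

/-- The image `a ∈ A` of the loop. -/
def LoopAlg.a : LoopAlg k := LoopAlg.ofPath k LoopPath.loop

/-- The homomorphism from `kQ` to the dual numbers `k[ε]` that sends a path `p` to
`ε ^ length p`. -/
def pathToDual : PathAlg k →ₐ[k] DualNumber k :=
  MonoidAlgebra.lift k (DualNumber k) LoopPath
    { toFun := fun p => DualNumber.eps ^ p.length
      map_one' := pow_zero _
      map_mul' := fun p q => by
        rw [← pow_add]
        exact congrArg _ (Quiver.Path.length_comp p q) }

theorem pathToDual_of (p : LoopPath) :
    pathToDual k (MonoidAlgebra.of k LoopPath p) = DualNumber.eps ^ p.length :=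
  MonoidAlgebra.lift_of _ _

theorem lengthTwoIdeal_le : lengthTwoIdeal k ≤ TwoSidedIdeal.ker (pathToDual k) := by
  rw [lengthTwoIdeal, TwoSidedIdeal.span_le]
  rintro x ⟨p, hp, rfl⟩
  rw [SetLike.mem_coe, TwoSidedIdeal.mem_ker]
  rw [pathToDual_of, hp, pow_two, DualNumber.eps_mul_eps]

/-- The induced homomorphism `A → k[ε]`, with `e ↦ 1` and `a ↦ ε`. -/
def LoopAlg.toDual : LoopAlg k →ₐ[k] DualNumber k :=
  RingCon.liftₐ _ (pathToDual k) (fun x y h => by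
    have := lengthTwoIdeal_le k ((lengthTwoIdeal k).rel_iff x y |>.1 h)
    rw [TwoSidedIdeal.mem_ker, map_sub, sub_eq_zero] at this
    exact this)

/-- The linear form on `A` that takes the coefficient of the loop `a` with respect to the basis of
`A` formed by the trivial path `e = 1` and `a`; it is characterised by `coeffA_a`,
`coeffA_one`. -/
def LoopAlg.coeffA : LoopAlg k →ₗ[k] k :=
  (TrivSqZeroExt.sndHom k k) ∘ₗ (LoopAlg.toDual k).toLinearMap

theorem LoopAlg.coeffA_one : LoopAlg.coeffA k 1 = 0 := by
  simp [LoopAlg.coeffA]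

theorem LoopAlg.coeffA_a : LoopAlg.coeffA k (LoopAlg.a k) = 1 := by
  have : LoopAlg.toDual k (LoopAlg.a k) = DualNumber.eps := by
    change pathToDual k (MonoidAlgebra.of k LoopPath LoopPath.loop) = _
    rw [pathToDual_of]
    exact pow_one _
  simp [LoopAlg.coeffA, this]

/-- The `n`-cochain `(a^n, a)`: the parallel pair `(a^n, a)` is the map `r^{⊗n} → A` with
`a ⊗ ⋯ ⊗ a ↦ a` on the radical `r = k a`, extended to `A^{⊗n}` by the projection `A → r`. So
`(x₁, …, x_n) ↦ c(x₁) ⋯ c(x_n) a`, where `c` is the coefficient of `a`. -/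
def loopCochain (n : ℕ) : Cochain k (LoopAlg k) n :=
  ((MultilinearMap.mkPiAlgebra k (Fin n) k).compLinearMap
    (fun _ => LoopAlg.coeffA k)).smulRight (LoopAlg.a k)

theorem loopCochain_apply (n : ℕ) (x : Fin n → LoopAlg k) :
    loopCochain k n x = (∏ i, LoopAlg.coeffA k (x i)) • LoopAlg.a k := by
  simp [loopCochain]

/-! ## The Witt algebra -/

/-- The Witt algebra: the Lie algebra of derivations of `k[T, T⁻¹]`. -/
abbrev Witt := Derivation k (LaurentPolynomial k) (LaurentPolynomial k)

/-- The Euler operator `T d/dT` on `k[T, T⁻¹]`, `T^j ↦ j T^j`. -/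
def euler : LaurentPolynomial k →ₗ[k] LaurentPolynomial k :=
  Finsupp.lsum k (fun j : ℤ => LinearMap.toSpanSingleton k _ ((j : k) • LaurentPolynomial.T j))
    ∘ₗ (AddMonoidAlgebra.coeffLinearEquiv k).toLinearMap

theorem euler_single (j : ℤ) (c : k) :
    euler k (AddMonoidAlgebra.single j c) = (j : k) • AddMonoidAlgebra.single j c := by
  change Finsupp.lsum k (fun j : ℤ => LinearMap.toSpanSingleton k (LaurentPolynomial k)
    ((j : k) • LaurentPolynomial.T j)) (Finsupp.single j c) = _
  rw [Finsupp.lsum_single, LinearMap.toSpanSingleton_apply, LaurentPolynomial.T, smul_comm,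
    AddMonoidAlgebra.smul_single, smul_eq_mul, mul_one]

/-- The element `L_i = -T^{i+1} d/dT` of the Witt algebra. -/
def Witt.L (i : ℤ) : Witt k :=
  Derivation.mk' (-(LinearMap.mulLeft k (LaurentPolynomial.T i)) ∘ₗ euler k) (fun x y => by
    have hE : euler k (x * y) = x * euler k y + y * euler k x := by
      induction x using AddMonoidAlgebra.induction_linear with
      | zero => simp
      | add x x' hx hx' => rw [add_mul, map_add, hx, hx', map_add]; ring
      | single i c =>
        induction y using AddMonoidAlgebra.induction_linear with
        | zero => simp
        | add y y' hy hy' => rw [mul_add, map_add, hy, hy', map_add]; ring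
        | single j d =>
          rw [AddMonoidAlgebra.single_mul_single, euler_single, euler_single, euler_single,
            mul_smul_comm, mul_smul_comm, AddMonoidAlgebra.single_mul_single,
            AddMonoidAlgebra.single_mul_single, add_comm j i, mul_comm d c, ← add_smul]
          push_cast
          rw [add_comm (j : k)]
    simp only [LinearMap.comp_apply, LinearMap.neg_apply, LinearMap.mulLeft_apply, hE,
      smul_eq_mul]
    ring)

theorem Witt.L_single (i j : ℤ) (c : k) :
    Witt.L k i (AddMonoidAlgebra.single j c) = -(j : k) • AddMonoidAlgebra.single (i + j) c := by
  change -(LaurentPolynomial.T i * euler k (AddMonoidAlgebra.single j c)) = _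
  rw [euler_single, mul_smul_comm, LaurentPolynomial.T, AddMonoidAlgebra.single_mul_single,
    one_mul, neg_smul]

theorem Witt.L_bracket (i j : ℤ) :
    ⁅Witt.L k i, Witt.L k j⁆ = ((i : k) - (j : k)) • Witt.L k (i + j) := by
  ext x
  induction x using AddMonoidAlgebra.induction_linear with
  | zero => simp
  | add x y hx hy => rw [map_add, map_add, AddMonoidAlgebra.coeff_add,
      AddMonoidAlgebra.coeff_add, Finsupp.add_apply, Finsupp.add_apply, hx, hy]
  | single l c =>
    rw [Derivation.commutator_apply, Derivation.smul_apply, Witt.L_single, Witt.L_single,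
      Derivation.map_smul, Derivation.map_smul, Witt.L_single, Witt.L_single, Witt.L_single,
      smul_smul, smul_smul, smul_smul, ← add_assoc, ← add_assoc, add_comm j i, ← sub_smul]
    congr 3
    push_cast
    ring

/-- The non-negative part of the Witt algebra: the Lie subalgebra with basis `L_i`, `i ≥ 0`. -/
def WittNonneg : LieSubalgebra k (Witt k) where
  __ := Submodule.span k (Set.range fun i : ℕ => Witt.L k i)
  lie_mem' {x y} hx hy := by
    change x ∈ Submodule.span k _ at hx
    change y ∈ Submodule.span k _ at hy
    change ⁅x, y⁆ ∈ Submodule.span k _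
    induction hx using Submodule.span_induction with
    | zero => rw [zero_lie (L := Witt k) (M := Witt k)]; exact zero_mem _
    | add u v _ _ hu hv => rw [add_lie (L := Witt k) (M := Witt k)]; exact add_mem hu hv
    | smul c u _ hu =>
      rw [smul_lie (R := k) (L := Witt k) (M := Witt k)]; exact Submodule.smul_mem _ c hu
    | mem u hu =>
      obtain ⟨i, rfl⟩ := hu
      induction hy using Submodule.span_induction with
      | zero => rw [lie_zero (L := Witt k) (M := Witt k)]; exact zero_mem _
      | add u v _ _ hu hv => rw [lie_add (L := Witt k) (M := Witt k)]; exact add_mem hu hv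
      | smul c u _ hu =>
        rw [lie_smul (R := k) (L := Witt k) (M := Witt k)]; exact Submodule.smul_mem _ c hu
      | mem v hv =>
        obtain ⟨j, rfl⟩ := hv
        change ⁅Witt.L k i, Witt.L k j⁆ ∈ _
        rw [Witt.L_bracket]
        exact Submodule.smul_mem _ _ (Submodule.subset_span ⟨i + j, by push_cast; rfl⟩)

end Hochschild

end

/-! Everything is read off from the value of a cochain at `(a, …, a)`. As `a * a = 0` and `a` is
central, the inner terms of the differential vanish there and only `(1 + (-1)^(n+1)) a f(a, …, a)`
remains. Hence coboundaries of odd degree vanish at `(a, …, a)`, while a cocycle of odd degree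
satisfies `2 a f(a, …, a) = 0`, so in characteristic zero its value is a multiple of `a`.

Conversely, a cocycle of odd degree is cohomologous to a normalized one (`exists_normalized`), and a
normalized cochain is determined by its value at `(a, …, a)`, since all other basis tuples contain
`1`. So the coefficient of `a` identifies each odd `HH^n` with `k`, with generator the class of
`(a^n, a)`. In odd degrees all signs in `f ∘ g` are `+1` and each of the `n` insertions contributes
the product of the two coefficients, whence the factor `n - m` (`coord_gerstenhaber`).

That the bracket of cocycles is a cocycle follows from the graded pre-Lie identity `compSeq_preLie`,
since in odd degree the differential is the commutator with the multiplication. Compatibility with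
coboundaries comes for free: the coefficient of a bracket depends only on the coefficients of its
factors. Antisymmetry and the Jacobi identity are pulled back from the Witt algebra along the linear
isomorphism.

Cochains are handled as functions of infinite sequences that depend on finitely many terms; this
keeps degrees out of the types when compositions are iterated. -/

noncomputable section

namespace Hochschild

/-! ### Insertion of functions into sequences -/

section Sequences

variable {A : Type*}

/-- The sequence obtained from `s` by feeding the block `s j, s (j+1), …` into `z`, which is
regarded as a function of `p + 1` arguments, and by putting the result at place `j`. -/
def insertSeq (j p : ℕ) (z : (ℕ → A) → A) (s : ℕ → A) : ℕ → A := fun l =>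
  if l < j then s l else if l = j then z (fun t => s (j + t)) else s (l + p)

/-- The function `z` depends only on the first `n` terms of a sequence. -/
def DependsOnFirst (n : ℕ) (z : (ℕ → A) → A) : Prop :=
  ∀ s s' : ℕ → A, (∀ l < n, s l = s' l) → z s = z s'

/-- The two blocks are disjoint, so the order of insertion only shifts the right-hand place by `p`,
the number of terms lost when `z` contracts its block. Dependence of `z` on `p + 1` terms is what
makes the blocks disjoint. -/
theorem insertSeq_comm {i j p q : ℕ} (hij : j < i) (y : (ℕ → A) → A) {z : (ℕ → A) → A}
    (hz : DependsOnFirst (p + 1) z) (s : ℕ → A) :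
    insertSeq i q y (insertSeq j p z s) = insertSeq j p z (insertSeq (i + p) q y s) := by
  funext l
  unfold insertSeq
  rcases lt_trichotomy l j with h | h | h
  · simp [h, h.trans hij, show l < i + p by omega]
  · subst h
    simp only [hij, lt_irrefl, if_true, if_false]
    apply hz
    intro t ht
    simp [show l + t < i + p by omega]
  · have h1 : ¬ l < j := by omega
    have h2 : l ≠ j := by omega
    simp only [h1, h2, if_false]
    rcases lt_trichotomy l i with h | h | h
    · simp [h]
    · subst h
      simp only [lt_irrefl, if_false, if_true]
      congr 1
      funext t
      simp only [show ¬ l + t < j by omega, show l + t ≠ j by omega, if_false]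
      congr 1
      omega
    · simp only [show ¬ l < i by omega, show l ≠ i by omega, show ¬ l + q < j by omega,
        show l + q ≠ j by omega, show ¬ l + p < i + p by omega, show l + p ≠ i + p by omega,
        if_false]
      congr 1
      omega

/-- The nested case: the result of `z` lies inside the block that is fed to `y`. -/
theorem insertSeq_insertSeq_of_le {i t p q : ℕ} (ht : t ≤ q) (y z : (ℕ → A) → A) (s : ℕ → A) :
    insertSeq i q y (insertSeq (i + t) p z s) =
      insertSeq i (q + p) (fun s' => y (insertSeq t p z s')) s := by
  funext l
  unfold insertSeq
  rcases lt_trichotomy l i with h | h | h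
  · simp [h, show l < i + t by omega]
  · subst h
    simp only [lt_irrefl, if_true, if_false]
    congr 1
    funext u
    simp only [add_lt_add_iff_left, add_right_inj, add_assoc]
  · simp only [show ¬ l < i by omega, show l ≠ i by omega, show ¬ l + q < i + t by omega,
      show l + q ≠ i + t by omega, if_false, add_assoc]

/-- Isolates the inserted value in a single coordinate, so that additivity in that argument applies.
-/
theorem insertSeq_eq_update (j p : ℕ) (z z' : (ℕ → A) → A) (s : ℕ → A) :
    insertSeq j p z s = Function.update (insertSeq j p z' s) j (z (fun t => s (j + t))) := by
  funext l
  by_cases h : l = j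
  · subst h; simp [insertSeq]
  · simp [insertSeq, h]

end Sequences

/-! ### The graded pre-Lie identity -/

section PreLie

variable {A : Type*} [AddCommGroup A]

/-- The signed sum of all insertions of `y`, of `q + 1` arguments, into `x`, of `n + 1`
arguments. -/
def compSeq (n q : ℕ) (x y : (ℕ → A) → A) (s : ℕ → A) : A :=
  ∑ i ∈ Finset.range (n + 1), (-1 : ℤ) ^ (i * q) • x (insertSeq i q y s)

/-- The signed sum of the insertions of `z` and `y` at distinct places of `x`, that of `z`
first. -/
def disjointInsertions (n q p : ℕ) (x y z : (ℕ → A) → A) (s : ℕ → A) : A :=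
  ∑ i ∈ Finset.range (n + 1), ∑ j ∈ Finset.range i,
    (-1 : ℤ) ^ (j * p + i * q) • x (insertSeq j p z (insertSeq (i + p) q y s))

/-- The function `x` of `n` arguments is additive in each of them. -/
def AdditiveInFirst (n : ℕ) (x : (ℕ → A) → A) : Prop :=
  ∀ (s : ℕ → A) (i : ℕ), i < n →
    ∃ φ : A →+ A, ∀ v, x (Function.update s i v) = φ v

theorem compSeq_compSeq_right {n q p : ℕ} {x : (ℕ → A) → A} (hx : AdditiveInFirst (n + 1) x)
    (y z : (ℕ → A) → A) (s : ℕ → A) :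
    compSeq n (q + p) x (compSeq q p y z) s =
      ∑ i ∈ Finset.range (n + 1), ∑ t ∈ Finset.range (q + 1),
        (-1 : ℤ) ^ ((i + t) * p + i * q) • x (insertSeq i q y (insertSeq (i + t) p z s)) := by
  unfold compSeq
  refine Finset.sum_congr rfl fun i hi => ?_
  obtain ⟨φ, hφ⟩ := hx (insertSeq i (q + p) (fun _ => 0) s) i (Finset.mem_range.1 hi)
  rw [insertSeq_eq_update i (q + p) _ (fun _ => 0), hφ, map_sum, Finset.smul_sum]
  refine Finset.sum_congr rfl fun t ht => ?_
  rw [insertSeq_insertSeq_of_le (by simpa [Nat.lt_succ_iff] using ht),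
    insertSeq_eq_update i (q + p) _ (fun _ => 0) s, hφ, map_zsmul, smul_smul, ← pow_add]
  congr 2
  ring

/-- With `y` at place `i` of `x`, the function `z` may enter to the left of `y`, inside `y`, or to
its right. The middle case gives `x ∘ (y ∘ z)`, and the outer ones give the two sums of disjoint
insertions. -/
theorem compSeq_compSeq_left {n q p : ℕ} {x y z : (ℕ → A) → A} (hx : AdditiveInFirst (n + 1) x)
    (hz : DependsOnFirst (p + 1) z) (s : ℕ → A) :
    compSeq (n + q) p (compSeq n q x y) z s =
      compSeq n (q + p) x (compSeq q p y z) s + disjointInsertions n q p x y z s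
        + (-1 : ℤ) ^ (p * q) • disjointInsertions n p q x z y s := by
  rw [compSeq_compSeq_right hx]
  have h1 : compSeq (n + q) p (compSeq n q x y) z s =
      ∑ i ∈ Finset.range (n + 1), ∑ j ∈ Finset.range (n + q + 1),
        (-1 : ℤ) ^ (j * p + i * q) • x (insertSeq i q y (insertSeq j p z s)) := by
    rw [Finset.sum_comm]
    unfold compSeq
    refine Finset.sum_congr rfl fun j _ => ?_
    rw [Finset.smul_sum]
    refine Finset.sum_congr rfl fun i _ => ?_
    rw [smul_smul, ← pow_add]
  have h2 : (-1 : ℤ) ^ (p * q) • disjointInsertions n p q x z y s =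
      ∑ i ∈ Finset.range (n + 1), ∑ j ∈ Finset.range (n - i),
        (-1 : ℤ) ^ ((i + (q + 1 + j)) * p + i * q) •
          x (insertSeq i q y (insertSeq (i + (q + 1 + j)) p z s)) := by
    have : disjointInsertions n p q x z y s = ∑ i ∈ Finset.range (n + 1),
        ∑ j ∈ Finset.Ico (i + 1) (n + 1),
        (-1 : ℤ) ^ (i * q + j * p) • x (insertSeq i q y (insertSeq (j + q) p z s)) := by
      unfold disjointInsertions
      refine Finset.sum_comm' ?_
      intro i j
      simp only [Finset.mem_range, Finset.mem_Ico]
      omega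
    rw [this, Finset.smul_sum]
    refine Finset.sum_congr rfl fun i _ => ?_
    rw [Finset.sum_Ico_eq_sum_range, Finset.smul_sum, show n + 1 - (i + 1) = n - i by omega]
    refine Finset.sum_congr rfl fun j _ => ?_
    rw [smul_smul, ← pow_add]
    have e : i + 1 + j + q = i + (q + 1 + j) := by omega
    rw [e, ← e]
    congr 2
    ring
  rw [h1, h2, disjointInsertions, ← Finset.sum_add_distrib, ← Finset.sum_add_distrib]
  refine Finset.sum_congr rfl fun i hi => ?_
  have hi' : i < n + 1 := Finset.mem_range.1 hi
  -- The `i` places before `y`, the `q + 1` places inside it and the `n - i` places after it.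
  rw [show n + q + 1 = i + (q + 1 + (n - i)) by omega, Finset.sum_range_add,
    Finset.sum_range_add, ← add_assoc]
  congr 1
  rw [add_comm]
  congr 1
  refine Finset.sum_congr rfl fun j hj => ?_
  rw [insertSeq_comm (Finset.mem_range.1 hj) y hz]

/-- The graded right pre-Lie identity. -/
theorem compSeq_preLie {n q p : ℕ} {x y z : (ℕ → A) → A} (hx : AdditiveInFirst (n + 1) x)
    (hy : DependsOnFirst (q + 1) y) (hz : DependsOnFirst (p + 1) z) (s : ℕ → A) :
    compSeq (n + q) p (compSeq n q x y) z s - compSeq n (q + p) x (compSeq q p y z) s =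
      (-1 : ℤ) ^ (p * q) • (compSeq (n + p) q (compSeq n p x z) y s -
        compSeq n (p + q) x (compSeq p q z y) s) := by
  -- Both associators consist of disjoint insertions only; exchanging `y` and `z` swaps the two sums
  -- up to the sign.
  rw [compSeq_compSeq_left hx hz, compSeq_compSeq_left hx hy, mul_comm q p, add_assoc,
    add_sub_cancel_left, add_assoc, add_sub_cancel_left, smul_add, smul_smul, ← pow_add,
    Even.neg_one_pow ⟨p * q, rfl⟩, one_smul, add_comm]

end PreLie

/-! ### Commutators of functions that commute with `M` -/

section CompSeq

variable {A : Type*} [AddCommGroup A]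

theorem compSeq_sub_left (n q : ℕ) (x x' y : (ℕ → A) → A) :
    compSeq n q (x - x') y = compSeq n q x y - compSeq n q x' y := by
  funext s
  simp [compSeq, smul_sub, Finset.sum_sub_distrib]

theorem compSeq_sub_right {n q : ℕ} {x : (ℕ → A) → A} (hx : AdditiveInFirst (n + 1) x)
    (y y' : (ℕ → A) → A) :
    compSeq n q x (y - y') = compSeq n q x y - compSeq n q x y' := by
  funext s
  simp only [compSeq, Pi.sub_apply, ← Finset.sum_sub_distrib]
  refine Finset.sum_congr rfl fun i hi => ?_
  obtain ⟨φ, hφ⟩ := hx (insertSeq i q (fun _ => 0) s) i (Finset.mem_range.1 hi)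
  rw [insertSeq_eq_update i q (y - y') (fun _ => 0) s, insertSeq_eq_update i q y (fun _ => 0) s,
    insertSeq_eq_update i q y' (fun _ => 0) s, hφ, hφ, hφ, Pi.sub_apply, map_sub, smul_sub]

/-- In even shifted degrees the commutator for `compSeq` of two functions which commute with `M`
commutes with `M`. -/
theorem compSeq_commutator_comm {p q : ℕ} (hp : Even p) (hq : Even q) {M F G : (ℕ → A) → A}
    (hM : AdditiveInFirst 2 M) (hM' : DependsOnFirst 2 M)
    (hF : AdditiveInFirst (p + 1) F) (hF' : DependsOnFirst (p + 1) F)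
    (hG : AdditiveInFirst (q + 1) G) (hG' : DependsOnFirst (q + 1) G)
    (hMF : compSeq 1 p M F = compSeq p 1 F M) (hMG : compSeq 1 q M G = compSeq q 1 G M) :
    compSeq 1 (p + q) M (compSeq p q F G - compSeq q p G F) =
      compSeq (p + q) 1 (compSeq p q F G - compSeq q p G F) M := by
  rw [compSeq_sub_left, compSeq_sub_right hM]
  funext s
  -- After the rewrites below, `h1` expresses `M ∘ [F, G]` through `(F ∘ M) ∘ G` and `(G ∘ M) ∘ F`,
  -- while `h2` and `h3` identify these with `(F ∘ G) ∘ M` and `(G ∘ F) ∘ M`.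
  have h1 := compSeq_preLie (n := 1) hM hF' hG' s
  have h2 := compSeq_preLie (p := 1) hF hG' hM' s
  have h3 := compSeq_preLie (p := 1) hG hF' hM' s
  rw [(hq.mul_right p).neg_one_pow, one_smul, hMF, hMG] at h1
  rw [one_mul, hq.neg_one_pow, one_smul, hMG, add_comm q 1, sub_left_inj] at h2
  rw [one_mul, hp.neg_one_pow, one_smul, hMF, add_comm p 1, sub_left_inj] at h3
  rw [add_comm q p, add_comm 1 p, add_comm 1 q] at h1
  rw [add_comm q p] at h3
  simp only [Pi.sub_apply, h2, h3]
  rw [sub_eq_sub_iff_add_eq_add] at h1 ⊢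
  rw [add_comm, h1.symm, add_comm]

end CompSeq

/-! ### Cochains as functions of sequences -/

section OnSeq

variable {k A : Type*} [CommRing k] [Ring A] [Algebra k A]

/-- A cochain of degree `n` as a function of the first `n` terms of a sequence. -/
def onSeq {n : ℕ} (f : Cochain k A n) (s : ℕ → A) : A := f (fun i => s i)

theorem onSeq_extend {n : ℕ} (f : Cochain k A n) (x : Fin n → A) :
    onSeq f (fun l => if h : l < n then x ⟨l, h⟩ else 0) = f x := by
  simp [onSeq]

theorem ext_onSeq {n : ℕ} {f g : Cochain k A n} (h : ∀ s, onSeq f s = onSeq g s) : f = g := by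
  ext x
  rw [← onSeq_extend f, h, onSeq_extend]

theorem dependsOnFirst_onSeq {n : ℕ} (f : Cochain k A n) : DependsOnFirst n (onSeq f) :=
  fun _ _ h => congrArg f (funext fun i => h i i.2)

theorem additiveInFirst_onSeq {n : ℕ} (f : Cochain k A n) : AdditiveInFirst n (onSeq f) := by
  intro s i hi
  refine ⟨(f.toLinearMap (fun j => s j) ⟨i, hi⟩).toAddMonoidHom, fun v => ?_⟩
  change f _ = f _
  congr 1
  funext j
  simp [Function.update_apply, Fin.ext_iff]

theorem onSeq_sub {n : ℕ} (f g : Cochain k A n) (s : ℕ → A) :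
    onSeq (f - g) s = onSeq f s - onSeq g s := rfl

theorem onSeq_circ {n q N : ℕ} (h : N + 1 = n + (q + 1)) (i : Fin n) (f : Cochain k A n)
    (g : Cochain k A (q + 1)) (s : ℕ → A) :
    onSeq (circ h i f g) s = onSeq f (insertSeq i q (onSeq g) s) := by
  change f (circArgs _ _ _ _) = f _
  congr 1
  funext l
  unfold circArgs insertSeq
  by_cases hl : (l : ℕ) < i
  · simp [hl]
  · by_cases hi : (l : ℕ) = i
    · simp [hi, onSeq]
    · simp only [hl, hi, dite_false, if_false]
      congr 1
      omega

theorem neg_one_pow_smul_eq (e : ℕ) (a : A) : (-1 : k) ^ e • a = (-1 : ℤ) ^ e • a := by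
  rcases Nat.even_or_odd e with h | h
  · rw [h.neg_one_pow, h.neg_one_pow, one_smul, one_smul]
  · rw [h.neg_one_pow, h.neg_one_pow, neg_one_smul, neg_one_smul]

theorem onSeq_comp {n q N : ℕ} (h : N + 1 = n + 1 + (q + 1)) (f : Cochain k A (n + 1))
    (g : Cochain k A (q + 1)) (s : ℕ → A) :
    onSeq (comp h f g) s = compSeq n q (onSeq f) (onSeq g) s := by
  unfold compSeq
  rw [Finset.sum_range]
  change comp h f g _ = _
  rw [comp, sum_apply]
  refine Finset.sum_congr rfl fun i _ => ?_
  rw [smul_apply, ← onSeq_circ h, neg_one_pow_smul_eq]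
  congr 1
  -- `comp` has the degree plus one in the exponent and `compSeq` the degree minus one; the
  -- difference `2 * i` is even.
  rw [show (i : ℕ) * (q + 1 + 1) = i * q + 2 * i by ring, pow_add _ (i * q : ℕ), pow_mul _ 2]
  simp

theorem onSeq_differential {n : ℕ} (f : Cochain k A n) (s : ℕ → A) :
    onSeq (differential k A n f) s =
      s 0 * onSeq f (fun t => s (t + 1))
        + ∑ i ∈ Finset.range n, (-1 : ℤ) ^ (i + 1) •
          onSeq f (insertSeq i 1 (onSeq (mulCochain k A)) s)
        + (-1 : ℤ) ^ (n + 1) • (onSeq f s * s n) := by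
  rw [onSeq, differential_apply]
  congr 1
  · congr 1
    rw [Finset.sum_range]
    refine Finset.sum_congr rfl fun i _ => ?_
    rw [neg_one_pow_smul_eq]
    congr 2
    funext j
    simp only [insertSeq, Fin.lt_def, Fin.ext_iff]
    rfl
  · rw [neg_one_pow_smul_eq]
    rfl

/-- The two insertions of `f` into the multiplication are the outer terms of the differential, and
the insertions of the multiplication into `f` are the inner ones. Thus the differential is the
commutator with the multiplication. -/
theorem onSeq_differential_of_even {p : ℕ} (hp : Even p) (f : Cochain k A (p + 1)) (s : ℕ → A) :
    onSeq (differential k A (p + 1) f) s =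
      compSeq 1 p (onSeq (mulCochain k A)) (onSeq f) s -
        compSeq p 1 (onSeq f) (onSeq (mulCochain k A)) s := by
  rw [onSeq_differential]
  have h1 : compSeq 1 p (onSeq (mulCochain k A)) (onSeq f) s =
      onSeq f s * s (p + 1) + s 0 * onSeq f (fun t => s (t + 1)) := by
    simp [compSeq, Finset.sum_range_succ, hp.neg_one_pow, insertSeq, onSeq, mulCochain, add_comm]
  have h2 : Even (p + 1 + 1) := by
    rw [add_assoc]; exact hp.add even_two
  rw [h1, h2.neg_one_pow, one_smul, compSeq]
  simp only [pow_succ, mul_one, mul_neg, neg_smul, Finset.sum_neg_distrib]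
  abel

/-- The bracket of two cocycles of odd degree is a cocycle. -/
theorem gerstenhaber_mem_cocycles {n m N : ℕ} (hn : Odd n) (hm : Odd m) (h : N + 1 = n + m)
    {f : Cochain k A n} {g : Cochain k A m} (hf : f ∈ cocycles k A n) (hg : g ∈ cocycles k A m) :
    gerstenhaber h f g ∈ cocycles k A N := by
  obtain ⟨a, rfl⟩ := hn
  obtain ⟨b, rfl⟩ := hm
  obtain rfl : N = 2 * a + 2 * b + 1 := by omega
  have ha : Even (2 * a) := even_two_mul a
  have hb : Even (2 * b) := even_two_mul b
  have key : ∀ {p : ℕ}, Even p → ∀ f ∈ cocycles k A (p + 1),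
      compSeq 1 p (onSeq (mulCochain k A)) (onSeq f) =
        compSeq p 1 (onSeq f) (onSeq (mulCochain k A)) := by
    intro p hp f hf
    funext s
    rw [← sub_eq_zero, ← onSeq_differential_of_even hp, LinearMap.mem_ker.1 hf]
    rfl
  refine LinearMap.mem_ker.2 (ext_onSeq fun s => ?_)
  have hfg : onSeq (gerstenhaber h f g) = compSeq (2 * a) (2 * b) (onSeq f) (onSeq g) -
      compSeq (2 * b) (2 * a) (onSeq g) (onSeq f) := by
    funext s
    have he : Even ((2 * a + 1 + 1) * (2 * b + 1 + 1)) :=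
      Even.mul_right ⟨a + 1, by ring⟩ _
    rw [gerstenhaber, he.neg_one_pow, one_smul, onSeq_sub, onSeq_comp, onSeq_comp, Pi.sub_apply]
  rw [onSeq_differential_of_even (ha.add hb), hfg, compSeq_commutator_comm ha hb
    (additiveInFirst_onSeq _) (dependsOnFirst_onSeq _) (additiveInFirst_onSeq _)
    (dependsOnFirst_onSeq _) (additiveInFirst_onSeq _) (dependsOnFirst_onSeq _)
    (key ha f hf) (key hb g hg), sub_self]
  rfl

end OnSeq

/-! ### Normalization of cocycles of odd degree -/

section CompSeq

variable {A : Type*} [AddCommGroup A]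

theorem compSeq_neg_left (n q : ℕ) (x y : (ℕ → A) → A) :
    compSeq n q (-x) y = -compSeq n q x y := by
  funext s
  simp [compSeq]

theorem compSeq_neg_right {n q : ℕ} {x : (ℕ → A) → A} (hx : AdditiveInFirst (n + 1) x)
    (y : (ℕ → A) → A) : compSeq n q x (-y) = -compSeq n q x y := by
  rw [← zero_sub y, ← sub_self y, compSeq_sub_right hx, compSeq_sub_right hx, sub_self, zero_sub]

end CompSeq

section Normalization

variable {k A : Type*} [CommRing k] [Ring A] [Algebra k A]

theorem onSeq_differential_of_odd {p : ℕ} (hp : Odd p) (f : Cochain k A (p + 1)) :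
    onSeq (differential k A (p + 1) f) =
      -compSeq 1 p (onSeq (mulCochain k A)) (onSeq f) -
        compSeq p 1 (onSeq f) (onSeq (mulCochain k A)) := by
  funext s
  rw [onSeq_differential]
  have h1 : compSeq 1 p (onSeq (mulCochain k A)) (onSeq f) s =
      onSeq f s * s (p + 1) - s 0 * onSeq f (fun t => s (t + 1)) := by
    simp [compSeq, Finset.sum_range_succ, hp.neg_one_pow, insertSeq, onSeq, mulCochain, add_comm,
      sub_eq_add_neg]
  have h2 : Odd (p + 1 + 1) := by
    rw [add_assoc]; exact hp.add_even even_two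
  rw [Pi.sub_apply, Pi.neg_apply, h1, h2.neg_one_pow, neg_one_smul, compSeq]
  simp only [pow_succ, mul_one, mul_neg, neg_smul, Finset.sum_neg_distrib]
  abel

/-- This is associativity: the two insertions are `(xy)z` and `-x(yz)`. -/
theorem compSeq_mul_mul :
    compSeq 1 1 (onSeq (mulCochain k A)) (onSeq (mulCochain k A)) = 0 := by
  funext s
  simp [compSeq, Finset.sum_range_succ, insertSeq, onSeq, mulCochain, mul_assoc]

/-- With `M` the multiplication and `M ∘ M = 0`, the pre-Lie identity gives `(M ∘ g) ∘ M - M ∘ (g ∘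
M) = M ∘ (M ∘ g)`, and `(g ∘ M) ∘ M = 0` because the disjoint insertions cancel in pairs. Only this
parity is needed, to correct cocycles of odd degree. -/
theorem differential_differential_of_even {n : ℕ} (hn : Even n) (g : Cochain k A n) :
    differential k A (n + 1) (differential k A n g) = 0 := by
  refine ext_onSeq fun s => ?_
  rw [onSeq_differential_of_even hn]
  rcases n with _ | p
  -- In degree zero `g` is a constant and its differential is an inner derivation.
  · have h0 : ∀ u u' : ℕ → A, onSeq g u = onSeq g u' := fun u u' =>
      dependsOnFirst_onSeq g _ _ (fun l hl => absurd hl (Nat.not_lt_zero l))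
    have h : onSeq (differential k A 0 g) = fun u => u 0 * onSeq g s - onSeq g s * u 0 := by
      funext u
      rw [onSeq_differential, h0 u s, h0 _ s]
      simp [sub_eq_add_neg]
    rw [h]
    simp only [compSeq, Finset.sum_range_succ, Finset.range_zero, Finset.sum_empty, insertSeq,
      onSeq, mulCochain, MultilinearMap.coe_mk]
    simp
    noncomm_ring
  · have hp : Odd p := by simpa [Nat.even_add_one] using hn
    have hM := additiveInFirst_onSeq (mulCochain k A)
    have hM' := dependsOnFirst_onSeq (mulCochain k A)
    have hg := additiveInFirst_onSeq g
    have hg' := dependsOnFirst_onSeq g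
    have h1 := compSeq_preLie (n := 1) hM hg' hM' s
    have h2 := compSeq_compSeq_left (q := 1) hg hM' (y := onSeq (mulCochain k A)) s
    have h0 : ∀ y, compSeq 2 p (0 : (ℕ → A) → A) y s = 0 := by simp [compSeq]
    have h0' : compSeq p 2 (onSeq g) (0 : (ℕ → A) → A) = 0 := by
      have := compSeq_sub_right hg (q := 2) 0 0
      rwa [sub_self, sub_self] at this
    norm_num at h1 h2
    rw [compSeq_mul_mul, hp.neg_one_pow, h0, zero_sub, neg_one_mul, neg_neg] at h1
    rw [compSeq_mul_mul, h0', Pi.zero_apply] at h2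
    rw [onSeq_differential_of_odd hp, compSeq_sub_right hM, compSeq_neg_right hM, compSeq_sub_left,
      compSeq_neg_left]
    simp only [Pi.sub_apply, Pi.neg_apply, h2]
    rw [add_comm 1 p] at h1
    rw [← h1]
    change _ = (0 : A)
    abel

/-- The first `n + 1` summands of the Hochschild differential of a cochain of degree `n`. -/
def face (m : ℕ) (F : (ℕ → A) → A) (s : ℕ → A) : A :=
  match m with
  | 0 => s 0 * F (fun t => s (t + 1))
  | m + 1 => (-1 : ℤ) ^ (m + 1) • F (insertSeq m 1 (fun u => u 0 * u 1) s)

theorem onSeq_differential_eq_sum_face {n : ℕ} (f : Cochain k A n) (s : ℕ → A) :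
    onSeq (differential k A n f) s =
      ∑ m ∈ Finset.range (n + 1), face m (onSeq f) s
        + (-1 : ℤ) ^ (n + 1) • (onSeq f s * s n) := by
  rw [onSeq_differential, Finset.sum_range_succ', add_comm (s 0 * _)]
  rfl

/-- When the last argument is `1`, the final summand has the form of one more `face`: the product it
forms lies beyond the arguments of `f`. -/
theorem onSeq_differential_eq_sum_face_of_eq_one {n : ℕ} (f : Cochain k A n) (s : ℕ → A)
    (hs : s n = 1) :
    onSeq (differential k A n f) s = ∑ m ∈ Finset.range (n + 2), face m (onSeq f) s := by
  rw [onSeq_differential_eq_sum_face, Finset.sum_range_succ _ (n + 1), hs, mul_one]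
  congr 2
  refine dependsOnFirst_onSeq f _ _ fun l hl => ?_
  simp [insertSeq, hl]

theorem face_eq_zero_of_lt {m j : ℕ} (hm : m < j) {F : (ℕ → A) → A} {s : ℕ → A} (hs : s j = 1)
    (hF : ∀ u : ℕ → A, u (j - 1) = 1 → F u = 0) : face m F s = 0 := by
  rcases m with _ | m
  · rw [face, hF _ (by rwa [Nat.sub_add_cancel hm]), mul_zero]
  · rw [face, hF, smul_zero]
    simp only [insertSeq, show ¬ j - 1 < m by omega, show j - 1 ≠ m by omega, if_false]
    rwa [Nat.sub_add_cancel (by omega)]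

theorem face_eq_zero_of_gt {m j : ℕ} (hm : j + 1 < m) {F : (ℕ → A) → A} {s : ℕ → A}
    (hs : s j = 1) (hF : ∀ u : ℕ → A, u j = 1 → F u = 0) : face m F s = 0 := by
  rcases m with _ | m
  · omega
  · rw [face, hF, smul_zero]
    simp only [insertSeq, show j < m by omega, if_true, hs]

/-- Multiplying the `1` at place `j` into either neighbour deletes it, and the two signs are
opposite. -/
theorem face_add_face {j : ℕ} {s : ℕ → A} (hs : s j = 1) (F : (ℕ → A) → A) :
    face j F s + face (j + 1) F s = 0 := by
  rcases j with _ | j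
  · have : insertSeq 0 1 (fun u => u 0 * u 1) s = fun t => s (t + 1) := by
      funext l
      rcases l with _ | l <;> simp [insertSeq, hs]
    simp [face, hs, this]
  · have : insertSeq (j + 1) 1 (fun u => u 0 * u 1) s =
        insertSeq j 1 (fun u => u 0 * u 1) s := by
      funext l
      unfold insertSeq
      rcases lt_trichotomy l j with h | h | h
      · simp [h, show l < j + 1 by omega]
      · simp [h, hs]
      · by_cases h' : l = j + 1
        · simp [h', hs]
        · simp [h', show ¬ l < j by omega, show l ≠ j by omega, show ¬ l < j + 1 by omega]
    rw [face, face, this, pow_succ _ (j + 1)]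
    simp

theorem sum_range_face {j : ℕ} {F : (ℕ → A) → A} {s : ℕ → A} (hs : s j = 1)
    (hF : 0 < j → ∀ u : ℕ → A, u (j - 1) = 1 → F u = 0) (r : ℕ) :
    ∑ m ∈ Finset.range (j + 2 + r), face m F s = ∑ m ∈ Finset.range r, face (j + 2 + m) F s := by
  rw [Finset.sum_range_add, Finset.sum_range_succ, Finset.sum_range_succ,
    add_assoc (Finset.sum _ _), face_add_face hs, Finset.sum_eq_zero, add_zero, zero_add]
  intro m hm
  have hm' := Finset.mem_range.1 hm
  exact face_eq_zero_of_lt hm' hs (hF (by omega))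

/-- The sequence `s` with a `1` inserted at place `i`. -/
def insertOne (i : ℕ) (s : ℕ → A) : ℕ → A := fun l =>
  if l < i then s l else if l = i then 1 else s (l - 1)

/-- The cochain `f` with the argument number `i` set to `1`. -/
def capOne {N : ℕ} (i : Fin (N + 1)) (f : Cochain k A (N + 1)) : Cochain k A N :=
  circ (m := 0) (by omega) i f (MultilinearMap.constOfIsEmpty k _ 1)

theorem onSeq_capOne {N : ℕ} (i : Fin (N + 1)) (f : Cochain k A (N + 1)) (s : ℕ → A) :
    onSeq (capOne i f) s = onSeq f (insertOne i s) := by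
  change f (circArgs _ _ _ _) = f _
  congr 1

theorem insertSeq_insertOne {i r : ℕ} (s : ℕ → A) (z : (ℕ → A) → A) :
    insertSeq (i + 2 + r) 1 z (insertOne i s) = insertOne i (insertSeq (i + 1 + r) 1 z s) := by
  funext l
  unfold insertSeq insertOne
  rcases lt_trichotomy l i with h | h | h
  · simp [h, show l < i + 1 + r by omega, show l < i + 2 + r by omega]
  · simp [h, show i < i + 2 + r by omega]
  · simp only [show ¬ l < i by omega, show l ≠ i by omega, if_false]
    rcases lt_trichotomy l (i + 2 + r) with h' | h' | h'
    · simp [h', show l - 1 < i + 1 + r by omega]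
    · subst h'
      simp only [lt_irrefl, if_false, if_true,
        show i + 2 + r - 1 = i + 1 + r by omega]
      congr 1
      funext t
      simp only [show ¬ i + 2 + r + t < i by omega, show i + 2 + r + t ≠ i by omega, if_false]
      congr 1
      omega
    · simp only [show ¬ l < i + 2 + r by omega, show l ≠ i + 2 + r by omega,
        show ¬ l - 1 < i + 1 + r by omega, show l - 1 ≠ i + 1 + r by omega,
        show ¬ l + 1 < i by omega, show l + 1 ≠ i by omega, if_false]
      congr 1
      omega

theorem onSeq_capOne_eq_zero {N : ℕ} {i : Fin (N + 1)} {f : Cochain k A (N + 1)} {j : ℕ}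
    (hj : j < i) (hV : ∀ s : ℕ → A, s j = 1 → onSeq f s = 0) (s : ℕ → A) (hs : s j = 1) :
    onSeq (capOne i f) s = 0 := by
  rw [onSeq_capOne]
  exact hV _ (by simp [insertOne, hj, hs])

/-- Ensures that the correction made at place `i` does not spoil the places already normalized. -/
theorem onSeq_differential_capOne_of_lt {N : ℕ} {i : Fin (N + 1)} {f : Cochain k A (N + 1)}
    (hV : ∀ j < (i : ℕ), ∀ s : ℕ → A, s j = 1 → onSeq f s = 0) {j : ℕ} (hj : j < i)
    {s : ℕ → A} (hs : s j = 1) : onSeq (differential k A N (capOne i f)) s = 0 := by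
  obtain ⟨r, hr⟩ : ∃ r, N + 1 = j + 2 + r := Nat.exists_eq_add_of_le (by omega)
  have hg := fun l hl => onSeq_capOne_eq_zero (i := i) hl (hV l hl)
  rw [onSeq_differential_eq_sum_face, hg j hj s hs, hr,
    sum_range_face hs (fun _ => hg (j - 1) (by omega)), Finset.sum_eq_zero, zero_mul, smul_zero,
    zero_add]
  intro m _
  exact face_eq_zero_of_gt (by omega) hs (hg j hj)

/-- Evaluate the cocycle equation of `f` at `s` with a second `1` inserted at place `i`. The faces
up to `i + 1` drop out, face `i + 2` restores `f s`, and the later ones are, up to sign, those of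
`capOne i f`. -/
theorem onSeq_differential_capOne_self {N : ℕ} {i : Fin (N + 1)} {f : Cochain k A (N + 1)}
    (hf : f ∈ cocycles k A (N + 1))
    (hV : ∀ j < (i : ℕ), ∀ s : ℕ → A, s j = 1 → onSeq f s = 0)
    {s : ℕ → A} (hs : s i = 1) :
    onSeq (differential k A N (capOne i f)) s = (-1 : ℤ) ^ (i : ℕ) • onSeq f s := by
  have hg := fun l hl => onSeq_capOne_eq_zero (i := i) hl (hV l hl)
  have hs' : insertOne i s i = 1 := by simp [insertOne]
  have hdf : onSeq (differential k A (N + 1) f) (insertOne i s) = 0 := by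
    rw [LinearMap.mem_ker.1 hf]; rfl
  have hface : ∀ r, face (i + 2 + (r + 1)) (onSeq f) (insertOne i s) =
      -face (i + 2 + r) (onSeq (capOne i f)) s := by
    intro r
    rw [show (i : ℕ) + 2 + (r + 1) = (i + 2 + r) + 1 by omega,
      show (i : ℕ) + 2 + r = (i + 1 + r) + 1 by omega, face, face, onSeq_capOne,
      ← insertSeq_insertOne, show (i : ℕ) + 1 + r + 1 = i + 2 + r by omega, pow_succ _ (i + 2 + r)]
    simp
  have hface0 : face (i + 2) (onSeq f) (insertOne i s) = (-1 : ℤ) ^ (i : ℕ) • onSeq f s := by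
    have : insertSeq (i + 1) 1 (fun u => u 0 * u 1) (insertOne i s) = s := by
      funext l
      unfold insertSeq insertOne
      rcases lt_trichotomy l i with h | h | h
      · simp [h, show l < (i : ℕ) + 1 by omega]
      · simp [h, hs]
      · by_cases h' : l = i + 1
        · simp [h', hs, show ¬ (i : ℕ) + 1 + 1 < i by omega, show (i : ℕ) + 1 + 1 ≠ i by omega]
        · simp [h',
            show ¬ l < (i : ℕ) + 1 by omega, show ¬ l + 1 < (i : ℕ) by omega,
            show l + 1 ≠ (i : ℕ) by omega]
    rw [face, this, pow_add, pow_add]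
    simp
  have key : ∀ r, ∑ m ∈ Finset.range (i + 2 + r), face m (onSeq (capOne i f)) s =
      (-1 : ℤ) ^ (i : ℕ) • onSeq f s -
        ∑ m ∈ Finset.range (i + 2 + (r + 1)), face m (onSeq f) (insertOne i s) := by
    intro r
    rw [sum_range_face hs (fun h => hg _ (by omega)),
      sum_range_face hs' (fun h => hV _ (by omega)), Finset.sum_range_succ', hface0]
    simp only [hface, Finset.sum_neg_distrib]
    abel
  -- For `i = N` the last argument is `1`, so the final summand has to be counted as a face.
  rcases (Nat.lt_succ_iff.1 i.2).lt_or_eq with hi | hi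
  · obtain ⟨r, hr⟩ : ∃ r, N + 1 = i + 2 + r := Nat.exists_eq_add_of_le (by omega)
    have hlast : insertOne i s (N + 1) = s N := by
      simp [insertOne, show ¬ N + 1 < (i : ℕ) by omega, show N + 1 ≠ (i : ℕ) by omega]
    rw [onSeq_differential_eq_sum_face, hlast, ← onSeq_capOne, pow_succ _ (N + 1)] at hdf
    have := key r
    rw [← hr, ← add_assoc, ← hr] at this
    rw [onSeq_differential_eq_sum_face, this, eq_neg_of_add_eq_zero_left hdf]
    simp
  · rw [onSeq_differential_eq_sum_face_of_eq_one _ _ (by rw [← hs]; exact congrArg s hi.symm)]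
    have hlast : insertOne i s (N + 1) = 1 := by
      simp [insertOne, ← hi, hs]
    rw [onSeq_differential_eq_sum_face_of_eq_one _ _ hlast] at hdf
    have := key 0
    rw [show (i : ℕ) + 2 + (0 + 1) = N + 1 + 2 by omega,
      show (i : ℕ) + 2 + 0 = N + 2 by omega, hdf, sub_zero] at this
    exact this

/-- Every cocycle of odd degree is cohomologous to a normalized one. -/
theorem exists_normalized {N : ℕ} (hN : Even N) {f : Cochain k A (N + 1)}
    (hf : f ∈ cocycles k A (N + 1)) (i : ℕ) (hi : i ≤ N + 1) :
    ∃ f' ∈ cocycles k A (N + 1), f - f' ∈ coboundaries k A (N + 1) ∧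
      ∀ j < i, ∀ s : ℕ → A, s j = 1 → onSeq f' s = 0 := by
  induction i with
  | zero => exact ⟨f, hf, by simp, by simp⟩
  | succ i ih =>
    obtain ⟨f', hf', hff', hV⟩ := ih (by omega)
    set g := capOne ⟨i, hi⟩ f'
    -- The sign cancels the one in `onSeq_differential_capOne_self`.
    refine ⟨f' - (-1 : k) ^ i • differential k A N g, ?_, ?_, ?_⟩
    · refine sub_mem hf' (Submodule.smul_mem _ _ (LinearMap.mem_ker.2 ?_))
      exact differential_differential_of_even hN g
    · rw [← sub_add]
      exact add_mem hff' (Submodule.smul_mem _ _ (LinearMap.mem_range_self _ g))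
    · intro j hj s hs
      have h : onSeq (f' - (-1 : k) ^ i • differential k A N g) s =
          onSeq f' s - (-1 : k) ^ i • onSeq (differential k A N g) s := rfl
      rw [h]
      rcases (Nat.lt_succ_iff.1 hj).lt_or_eq with hj | rfl
      · rw [hV j hj s hs, onSeq_differential_capOne_of_lt hV hj hs, smul_zero, sub_zero]
      · rw [onSeq_differential_capOne_self hf' hV hs, neg_one_pow_smul_eq, smul_smul,
          ← pow_add, Even.neg_one_pow ⟨_, rfl⟩, one_smul, sub_self]

end Normalization

/-! ### Paths of the loop quiver and the relation `a * a = 0` -/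

section LoopAlgebra

variable (k : Type*) [Field k]

theorem LoopPath.heq_of_length_eq {a : LoopQuiver} : ∀ {b c : LoopQuiver}
    (p : Quiver.Path a b) (q : Quiver.Path a c), Quiver.Path.length p = Quiver.Path.length q →
      HEq p q
  | _, _, .nil, .nil, _ => HEq.rfl
  | _, _, .nil, .cons _ _, h => absurd h (by simp)
  | _, _, .cons _ _, .nil, h => absurd h (by simp)
  | _, _, .cons (b := b) (c := c) p e, .cons (b := b') (c := c') q e', h => by
    obtain rfl : b = b' := Subsingleton.elim (α := Unit) b b'
    obtain rfl : c = c' := Subsingleton.elim (α := Unit) c c'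
    obtain rfl : e = e' := Subsingleton.elim (α := Unit) e e'
    rw [eq_of_heq (heq_of_length_eq p q (Nat.succ_injective h))]

theorem LoopPath.eq_of_length_eq {p q : LoopPath} (h : p.length = q.length) : p = q :=
  eq_of_heq (heq_of_length_eq p q h)

theorem LoopPath.length_loop_pow (n : ℕ) : (LoopPath.loop ^ n).length = n := by
  induction n with
  | zero => rfl
  | succ n ih =>
    rw [pow_succ]
    exact (Quiver.Path.length_comp _ _).trans (congrArg (· + 1) ih)

theorem LoopPath.eq_loop_pow (p : LoopPath) : p = LoopPath.loop ^ p.length :=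
  LoopPath.eq_of_length_eq (LoopPath.length_loop_pow _).symm

theorem LoopAlg.toDual_a : LoopAlg.toDual k (LoopAlg.a k) = DualNumber.eps := by
  change pathToDual k (MonoidAlgebra.of k LoopPath LoopPath.loop) = _
  rw [pathToDual_of]
  exact pow_one _

theorem LoopAlg.a_mul_a : LoopAlg.a k * LoopAlg.a k = 0 := by
  refine (RingCon.eq _).2 ?_
  rw [TwoSidedIdeal.rel_iff, sub_zero]
  change MonoidAlgebra.of k LoopPath _ * MonoidAlgebra.of k LoopPath _ ∈ _
  rw [← map_mul, ← pow_two]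
  exact TwoSidedIdeal.subset_span ⟨_, LoopPath.length_loop_pow 2, rfl⟩

end LoopAlgebra

/-! ### Cochains on an algebra with basis `1, a` -/

section DualBasis

variable {k A : Type*} [Field k] [Ring A] [Algebra k A]

/-- The algebra `A` has the basis `1, a` with `a ^ 2 = 0`, and `c₀`, `c` are the coordinates. -/
structure IsDualBasis (a : A) (c₀ c : A →ₗ[k] k) : Prop where
  sq_eq_zero : a * a = 0
  coeff_one : c₀ 1 = 1
  coeff_a : c₀ a = 0
  coord_one : c 1 = 0
  coord_a : c a = 1
  eq_add : ∀ x, x = c₀ x • 1 + c x • a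

/-- The coordinates are the components in the dual numbers. Every path is a power of the loop, so
its image is `1`, `a` or `0`, and these images span. -/
theorem isDualBasis_of_surjective {π : PathAlg k →ₐ[k] A} (hπ : Function.Surjective π)
    {D : A →ₐ[k] DualNumber k} {a : A} (ha : π (MonoidAlgebra.of k LoopPath LoopPath.loop) = a)
    (haa : a * a = 0) (hD : D a = DualNumber.eps) :
    IsDualBasis a ((TrivSqZeroExt.fstHom k k k).toLinearMap ∘ₗ D.toLinearMap)
      (TrivSqZeroExt.sndHom k k ∘ₗ D.toLinearMap) where
  sq_eq_zero := haa
  coeff_one := by simp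
  coeff_a := by simp [hD]
  coord_one := by simp
  coord_a := by simp [hD]
  eq_add x := by
    obtain ⟨y, rfl⟩ := hπ x
    induction y using MonoidAlgebra.induction_on with
    | of p =>
      rw [p.eq_loop_pow, map_pow, map_pow, ha]
      rcases p.length with _ | _ | n
      · simp
      · simp [hD]
      · simp [pow_add, mul_assoc, haa]
    | add y z hy hz =>
      rw [map_add, map_add, map_add, add_smul, add_smul, add_add_add_comm, ← hy, ← hz]
    | smul c y hy =>
      rw [map_smul, map_smul, map_smul, smul_assoc, smul_assoc, ← smul_add, ← hy]

namespace IsDualBasis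

variable {a : A} {c₀ c : A →ₗ[k] k}

/-- The basis `1, a` of `A`. -/
def basis (H : IsDualBasis a c₀ c) : Module.Basis (Fin 2) k A :=
  Module.Basis.mk (v := ![1, a])
    (by
      rw [LinearIndependent.pair_iff]
      intro s t h
      have h1 := congrArg c₀ h
      have h2 := congrArg c h
      simp [H.coeff_one, H.coeff_a, H.coord_one, H.coord_a] at h1 h2
      exact ⟨h1, h2⟩)
    (by
      intro x _
      rw [H.eq_add x]
      exact add_mem (Submodule.smul_mem _ _ (Submodule.subset_span ⟨0, rfl⟩))
        (Submodule.smul_mem _ _ (Submodule.subset_span ⟨1, rfl⟩)))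

theorem basis_zero (H : IsDualBasis a c₀ c) : H.basis 0 = 1 := by simp [basis]

theorem basis_one (H : IsDualBasis a c₀ c) : H.basis 1 = a := by simp [basis]

/-- A normalized cochain is determined by its value at `(a, …, a)`. -/
theorem eq_of_normalized (H : IsDualBasis a c₀ c) {n : ℕ} {f g : Cochain k A n}
    (hf : ∀ x : Fin n → A, ∀ j, x j = 1 → f x = 0)
    (hg : ∀ x : Fin n → A, ∀ j, x j = 1 → g x = 0)
    (h : f (fun _ => a) = g (fun _ => a)) : f = g := by
  refine Module.Basis.ext_multilinear (fun _ => H.basis) fun v => ?_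
  by_cases hv : ∃ j, v j = 0
  · obtain ⟨j, hj⟩ := hv
    have hj' : (fun i => H.basis (v i)) j = 1 := by
      simp only [hj, H.basis_zero]
    rw [hf _ j hj', hg _ j hj']
  · have : (fun i => H.basis (v i)) = fun _ => a := by
      funext i
      rw [Fin.eq_one_of_ne_zero _ fun h => hv ⟨i, h⟩, H.basis_one]
    rw [this, h]

theorem commute (H : IsDualBasis a c₀ c) (x : A) : Commute a x := by
  rw [H.eq_add x]
  exact ((Commute.one_right _).smul_right _).add_right ((Commute.refl _).smul_right _)

theorem coord_a_mul (H : IsDualBasis a c₀ c) (x : A) : c (a * x) = c₀ x := by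
  conv_lhs => rw [H.eq_add x]
  simp [mul_add, H.sq_eq_zero, H.coord_a]

/-- Each inner term has an argument `a * a = 0`, and the outer two combine because `a` is central.
-/
theorem differential_apply_a (H : IsDualBasis a c₀ c) {n : ℕ} (f : Cochain k A n) :
    differential k A n f (fun _ => a) = (1 + (-1 : k) ^ (n + 1)) • (a * f fun _ => a) := by
  rw [differential_apply, Finset.sum_eq_zero, add_zero, add_smul, one_smul, (H.commute _).eq]
  intro i _
  rw [H.sq_eq_zero, f.map_coord_zero i (by simp), smul_zero]

theorem coord_eq_zero_of_mem_coboundaries (H : IsDualBasis a c₀ c) {n : ℕ} (hn : Odd n)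
    {f : Cochain k A n} (hf : f ∈ coboundaries k A n) : c (f fun _ => a) = 0 := by
  obtain ⟨m, rfl⟩ := hn
  obtain ⟨g, rfl⟩ := hf
  rw [H.differential_apply_a, (odd_two_mul_add_one m).neg_one_pow]
  simp

/-- The cocycle equation at `(a, …, a)` reads `2 a f(a, …, a) = 0`; dividing by `2` kills the
coefficient of `1`. -/
theorem apply_a_of_mem_cocycles (H : IsDualBasis a c₀ c) [CharZero k] {n : ℕ} (hn : Odd n)
    {f : Cochain k A n} (hf : f ∈ cocycles k A n) :
    f (fun _ => a) = c (f fun _ => a) • a := by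
  have h := H.differential_apply_a f
  rw [LinearMap.mem_ker.1 hf, hn.add_one.neg_one_pow, one_add_one_eq_two] at h
  have h' := congrArg c h.symm
  rw [map_smul, H.coord_a_mul] at h'
  have h'' : c₀ (f fun _ => a) = 0 := by simpa using h'
  conv_lhs => rw [H.eq_add (f _), h'', zero_smul, zero_add]

/-- The value of `g` at `(a, …, a)` is a multiple of `a`, so all `n` insertions into `f` agree
there; their signs are `+1` as `m` is odd. -/
theorem coord_comp (H : IsDualBasis a c₀ c) [CharZero k] {n m N : ℕ} (hm : Odd m)
    (h : N + 1 = n + m) (f : Cochain k A n) {g : Cochain k A m} (hg : g ∈ cocycles k A m) :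
    c (comp h f g fun _ => a) = n * (c (f fun _ => a) * c (g fun _ => a)) := by
  have hcirc : ∀ i, circ h i f g (fun _ => a) = c (g fun _ => a) • f (fun _ => a) := by
    intro i
    change f (circArgs h i g fun _ => a) = _
    have : circArgs h i g (fun _ => a) =
        Function.update (fun _ => a) i (c (g fun _ => a) • a) := by
      rw [← H.apply_a_of_mem_cocycles hm hg]
      funext l
      by_cases hl : l = i
      · subst hl; simp [circArgs]
      · have : (l : ℕ) ≠ i := fun h' => hl (Fin.ext h')
        simp [circArgs, this, hl]
    rw [this, f.map_update_smul, Function.update_eq_self]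
  rw [comp, sum_apply, map_sum]
  have : ∀ i : Fin n, ((-1 : k) ^ ((i : ℕ) * (m + 1)) • circ h i f g) (fun _ => a) =
      c (g fun _ => a) • f (fun _ => a) := by
    intro i
    rw [smul_apply, hcirc, (hm.add_one.mul_left _).neg_one_pow, one_smul]
  simp [this, mul_comm (c (g _))]

theorem coord_gerstenhaber (H : IsDualBasis a c₀ c) [CharZero k] {n m N : ℕ} (hn : Odd n)
    (hm : Odd m) (h : N + 1 = n + m) {f : Cochain k A n} {g : Cochain k A m}
    (hf : f ∈ cocycles k A n) (hg : g ∈ cocycles k A m) :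
    c (gerstenhaber h f g fun _ => a) = (n - m) * (c (f fun _ => a) * c (g fun _ => a)) := by
  rw [gerstenhaber, (hn.add_one.mul_right _).neg_one_pow, one_smul, sub_apply, map_sub,
    H.coord_comp hm h f hg, H.coord_comp hn _ g hf]
  ring

end IsDualBasis

end DualBasis

/-! ### Coordinates on the loop algebra and the cochains `(a^n, a)` -/

section LoopAlgebra

variable (k : Type*) [Field k]

/-- The coefficient of the trivial path. -/
def LoopAlg.coeffOne : LoopAlg k →ₗ[k] k :=
  (TrivSqZeroExt.fstHom k k k).toLinearMap ∘ₗ (LoopAlg.toDual k).toLinearMap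

theorem LoopAlg.isDualBasis :
    IsDualBasis (LoopAlg.a k) (LoopAlg.coeffOne k) (LoopAlg.coeffA k) :=
  isDualBasis_of_surjective (π := (lengthTwoIdeal k).ringCon.mkₐ k)
    (RingCon.mk'_surjective _) rfl (LoopAlg.a_mul_a k) (LoopAlg.toDual_a k)

theorem loopCochain_apply_a (n : ℕ) :
    loopCochain k n (fun _ => LoopAlg.a k) = LoopAlg.a k := by
  rw [loopCochain_apply]
  simp only [LoopAlg.coeffA_a, Finset.prod_const_one]
  exact one_smul k (LoopAlg.a k)

theorem loopCochain_normalized {n : ℕ} (x : Fin n → LoopAlg k) (j : Fin n) (hj : x j = 1) :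
    loopCochain k n x = 0 := by
  rw [loopCochain_apply, Finset.prod_eq_zero (Finset.mem_univ j)]
  · exact zero_smul k (LoopAlg.a k)
  · rw [hj, LoopAlg.coeffA_one]

end LoopAlgebra

/-! ### Differentials of normalized cochains -/

section Normalized

variable {k A : Type*} [CommRing k] [Ring A] [Algebra k A]

theorem differential_normalized {n : ℕ} {f : Cochain k A n}
    (hf : ∀ x : Fin n → A, ∀ j, x j = 1 → f x = 0) (x : Fin (n + 1) → A) (j : Fin (n + 1))
    (hx : x j = 1) : differential k A n f x = 0 := by
  have hV : ∀ i < n, ∀ s : ℕ → A, s i = 1 → onSeq f s = 0 := fun i hi s hs =>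
    hf (fun l => s l) ⟨i, hi⟩ hs
  rw [← onSeq_extend (differential k A n f)]
  set s : ℕ → A := fun l => if h : l < n + 1 then x ⟨l, h⟩ else 0
  have hs : s j = 1 := (dif_pos j.2).trans hx
  rcases (Nat.lt_succ_iff.1 j.2).lt_or_eq with hj | hj
  · obtain ⟨r, hr⟩ : ∃ r, n + 1 = j + 2 + r := Nat.exists_eq_add_of_le (by omega)
    rw [onSeq_differential_eq_sum_face, hV j hj s hs, zero_mul, smul_zero, add_zero, hr,
      sum_range_face hs (fun _ => hV (j - 1) (by omega)), Finset.sum_eq_zero]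
    intro m _
    exact face_eq_zero_of_gt (by omega) hs (hV j hj)
  · rw [onSeq_differential_eq_sum_face_of_eq_one _ _ (by rw [← hs]; exact congrArg s hj.symm)]
    have := sum_range_face hs (fun _ => hV (j - 1) (by omega)) 0
    rwa [add_zero, show (j : ℕ) + 2 = n + 2 by omega] at this

end Normalized

/-! ### Linear algebra of subquotients, direct sums and brackets -/

section Subquotient

variable {R M P : Type*} [Ring R] [AddCommGroup M] [Module R M] [AddCommGroup P] [Module R P]

/-- The isomorphism `Z / B → P` induced by a surjection `Z → P` with kernel `B ∩ Z`. -/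
def Subquotient.equivOfSurjective {Z B : Submodule R M} {l : Z →ₗ[R] P}
    (hl : Function.Surjective l) (h : ∀ z, l z = 0 ↔ (z : M) ∈ B) : Subquotient Z B ≃ₗ[R] P :=
  (Submodule.quotEquivOfEq _ _ (by ext z; exact (h z).symm)).trans (l.quotKerEquivOfSurjective hl)

theorem Subquotient.equivOfSurjective_mk {Z B : Submodule R M} {l : Z →ₗ[R] P}
    (hl : Function.Surjective l) (h : ∀ z, l z = 0 ↔ (z : M) ∈ B) (z : Z) :
    Subquotient.equivOfSurjective hl h (Subquotient.mk Z B z) = l z := rfl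

end Subquotient

section DirectSum

variable {ι k : Type*} [DecidableEq ι] [Field k] {V : ι → Type*} [∀ i, AddCommGroup (V i)]
  [∀ i, Module k (V i)]

open Classical in
/-- The basis of a direct sum of one-dimensional spaces. -/
def basisOfEquiv (e : ∀ i, V i ≃ₗ[k] k) : Module.Basis ι k (⨁ i, V i) :=
  Module.Basis.ofRepr
    ((DFinsupp.mapRange.linearEquiv e).trans (finsuppLequivDFinsupp (ι := ι) (M := k) k).symm)

theorem basisOfEquiv_repr_lof (e : ∀ i, V i ≃ₗ[k] k) (i : ι) (v : V i) :
    (basisOfEquiv e).repr (DirectSum.lof k ι V i v) = Finsupp.single i (e i v) := by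
  classical
  change (finsuppLequivDFinsupp (ι := ι) (M := k) k).symm
    (DFinsupp.mapRange (fun i x => e i x) (fun i => map_zero (e i)) (DFinsupp.single i v)) = _
  rw [LinearEquiv.symm_apply_eq, DFinsupp.mapRange_single]
  ext j
  by_cases h : i = j
  · subst h; simp
  · simp [h]

end DirectSum

section Lie

theorem map_eq_lie_of_basis {ι k V L : Type*} [CommRing k] [AddCommGroup V] [Module k V]
    [LieRing L] [LieAlgebra k L] (b : Module.Basis ι k V) (B : V →ₗ[k] V →ₗ[k] V) (φ : V →ₗ[k] L)
    (h : ∀ i j, φ (B (b i) (b j)) = ⁅φ (b i), φ (b j)⁆) (x y : V) : φ (B x y) = ⁅φ x, φ y⁆ := by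
  have : B.compr₂ φ = (LieModule.toEnd k L L : L →ₗ[k] Module.End k L).compl₁₂ φ φ :=
    b.ext fun i => b.ext fun j => h i j
  exact LinearMap.congr_fun₂ this x y

end Lie

/-! ### The odd cohomology of the loop algebra and its bracket -/

section LoopAlgebra

variable (k : Type*) [Field k]

/-- The differential is again normalized, so it is enough that it vanishes at `(a, …, a)`, where it
is a multiple of `a * a`. -/
theorem loopCochain_mem_cocycles {n : ℕ} :
    loopCochain k n ∈ cocycles k (LoopAlg k) n := by
  refine LinearMap.mem_ker.2 ((LoopAlg.isDualBasis k).eq_of_normalized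
    (differential_normalized fun x j => loopCochain_normalized k x j) (fun _ _ _ => rfl) ?_)
  rw [(LoopAlg.isDualBasis k).differential_apply_a, loopCochain_apply_a, LoopAlg.a_mul_a,
    smul_zero, zero_apply]

/-- The linear form on cocycles that takes the coefficient of `a` in the value at `(a, …, a)`. -/
def leadingCoeff (n : ℕ) : cocycles k (LoopAlg k) n →ₗ[k] k where
  toFun f := LoopAlg.coeffA k ((f : Cochain k (LoopAlg k) n) fun _ => LoopAlg.a k)
  map_add' _ _ := map_add _ _ _
  map_smul' _ _ := map_smul _ _ _

theorem leadingCoeff_loopCochain (n : ℕ) :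
    leadingCoeff k n ⟨loopCochain k n, loopCochain_mem_cocycles k⟩ = 1 := by
  change LoopAlg.coeffA k (loopCochain k n _) = 1
  rw [loopCochain_apply_a, LoopAlg.coeffA_a]

theorem surjective_leadingCoeff (n : ℕ) : Function.Surjective (leadingCoeff k n) := fun t =>
  ⟨t • ⟨loopCochain k n, loopCochain_mem_cocycles k⟩, by
    rw [map_smul, leadingCoeff_loopCochain, smul_eq_mul, mul_one]⟩

variable [CharZero k]

/-- A normalized representative of the class of `f` has the same coefficient at `(a, …, a)`, hence
equals that multiple of `(a^n, a)`. -/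
theorem sub_smul_loopCochain_mem_coboundaries {n : ℕ} (hn : Odd n)
    {f : Cochain k (LoopAlg k) n} (hf : f ∈ cocycles k (LoopAlg k) n) :
    f - LoopAlg.coeffA k (f fun _ => LoopAlg.a k) • loopCochain k n ∈
      coboundaries k (LoopAlg k) n := by
  obtain ⟨N, rfl⟩ : ∃ N, n = N + 1 := ⟨n - 1, by have := hn.pos; omega⟩
  have hN : Even N := by simpa [Nat.odd_add_one] using hn
  have H := LoopAlg.isDualBasis k
  obtain ⟨f', hf', hff', hV⟩ := exists_normalized hN hf (N + 1) le_rfl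
  have hc := H.coord_eq_zero_of_mem_coboundaries hn hff'
  rw [sub_apply, map_sub, sub_eq_zero] at hc
  have : f' = LoopAlg.coeffA k (f fun _ => LoopAlg.a k) • loopCochain k (N + 1) := by
    refine H.eq_of_normalized (fun x j hj => ?_) (fun x j hj => ?_) ?_
    · rw [← onSeq_extend f']
      exact hV j j.2 _ ((dif_pos j.2).trans hj)
    · rw [smul_apply, loopCochain_normalized k x j hj, smul_zero]
    · rw [smul_apply, loopCochain_apply_a, H.apply_a_of_mem_cocycles hn hf', hc]
  rwa [← this]

theorem leadingCoeff_eq_zero_iff {n : ℕ} (hn : Odd n) (f : cocycles k (LoopAlg k) n) :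
    leadingCoeff k n f = 0 ↔ (f : Cochain k (LoopAlg k) n) ∈ coboundaries k (LoopAlg k) n := by
  refine ⟨fun h => ?_, (LoopAlg.isDualBasis k).coord_eq_zero_of_mem_coboundaries hn⟩
  have := sub_smul_loopCochain_mem_coboundaries k hn f.2
  change _ - leadingCoeff k n f • _ ∈ _ at this
  rwa [h, zero_smul, sub_zero] at this

/-- `HH^n(A)` is one-dimensional for odd `n`. -/
def oddHHEquiv {n : ℕ} (hn : Odd n) : HH k (LoopAlg k) n ≃ₗ[k] k :=
  Subquotient.equivOfSurjective (surjective_leadingCoeff k n) (leadingCoeff_eq_zero_iff k hn)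

/-- The basis of `HH^{odd}(A)` formed by the classes of the `(a^n, a)`. -/
def oddBasis : Module.Basis {n : ℕ // Odd n} k (HHOdd k (LoopAlg k)) :=
  basisOfEquiv fun n : {n : ℕ // Odd n} => oddHHEquiv k n.2

theorem oddBasis_repr_oddClass {n : ℕ} (hn : Odd n) (f : cocycles k (LoopAlg k) n) :
    (oddBasis k).repr (oddClass hn f) = Finsupp.single ⟨n, hn⟩ (leadingCoeff k n f) :=
  (basisOfEquiv_repr_lof _ _ _).trans
    (congrArg _ (Subquotient.equivOfSurjective_mk _ (leadingCoeff_eq_zero_iff k hn) f))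

theorem oddBasis_apply {n : ℕ} (hn : Odd n) :
    oddBasis k ⟨n, hn⟩ = oddClass hn ⟨loopCochain k n, loopCochain_mem_cocycles k⟩ := by
  apply (oddBasis k).repr.injective
  rw [oddBasis_repr_oddClass, Module.Basis.repr_self, leadingCoeff_loopCochain]

theorem oddClass_eq {n : ℕ} (hn : Odd n) (f : cocycles k (LoopAlg k) n) :
    oddClass hn f = leadingCoeff k n f • oddBasis k ⟨n, hn⟩ := by
  apply (oddBasis k).repr.injective
  rw [oddBasis_repr_oddClass, map_smul, Module.Basis.repr_self, Finsupp.smul_single, smul_eq_mul,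
    mul_one]

/-- The bracket of `HH^{odd}(A)`. -/
def oddBracket : HHOdd k (LoopAlg k) →ₗ[k] HHOdd k (LoopAlg k) →ₗ[k] HHOdd k (LoopAlg k) :=
  (oddBasis k).constr k fun n => (oddBasis k).constr k fun m =>
    -- The subtraction is not truncated, as odd numbers are positive.
    ((n.1 : k) - (m.1 : k)) • oddBasis k ⟨n.1 + m.1 - 1, Nat.Even.sub_odd
      (by have := n.2.pos; omega) (n.2.add_odd m.2) odd_one⟩

theorem oddBracket_oddBasis {n m N : ℕ} (hn : Odd n) (hm : Odd m) (hN : Odd N)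
    (h : N + 1 = n + m) :
    oddBracket k (oddBasis k ⟨n, hn⟩) (oddBasis k ⟨m, hm⟩) =
      ((n : k) - (m : k)) • oddBasis k ⟨N, hN⟩ := by
  obtain rfl : N = n + m - 1 := by omega
  simp [oddBracket]

/-- A class of odd degree is its leading coefficient times a basis vector, so the comparison reduces
to `coord_gerstenhaber`. -/
theorem isInducedBracket_oddBracket : IsInducedBracket (oddBracket k) := by
  intro n m N hn hm hN h f g
  refine ⟨gerstenhaber_mem_cocycles hn hm h f.2 g.2, ?_⟩
  rw [oddClass_eq, oddClass_eq, oddClass_eq, map_smul, map_smul, LinearMap.smul_apply,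
    oddBracket_oddBasis k hn hm hN h]
  have hs : ∀ (c d : k) (x : HHOdd k (LoopAlg k)), c • d • x = (c * d) • x :=
    fun c d x => smul_smul c d x
  rw [hs, hs]
  congr 1
  change _ = LoopAlg.coeffA k (gerstenhaber h (f : Cochain k (LoopAlg k) n) _ _)
  rw [(LoopAlg.isDualBasis k).coord_gerstenhaber hn hm h f.2 g.2]
  change leadingCoeff k m g * leadingCoeff k n f * _ =
    _ * (leadingCoeff k n f * leadingCoeff k m g)
  ring

end LoopAlgebra

/-! ### Comparison with the Witt algebra -/

section Witt

variable (k : Type*) [Field k]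

/-- Evaluating `-L_i` at `T` gives `T^(i+1)`, and distinct monomials are independent. -/
theorem linearIndependent_L : LinearIndependent k fun i : ℕ => Witt.L k i := by
  have h : LinearIndependent k fun i : ℕ =>
      (AddMonoidAlgebra.single ((i : ℤ) + 1) 1 : LaurentPolynomial k) := by
    have hb := (Finsupp.linearIndependent_single_one k ℤ).comp (fun i : ℕ => (i : ℤ) + 1)
      (fun i j hij => by simpa using hij)
    exact LinearIndependent.of_comp (AddMonoidAlgebra.coeffLinearEquiv k).toLinearMap hb
  let ev : Witt k →ₗ[k] LaurentPolynomial k :=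
    { toFun := fun D => -D (AddMonoidAlgebra.single 1 1)
      map_add' := fun D D' => by simp [add_comm]
      map_smul' := fun c D => by simp }
  refine LinearIndependent.of_comp ev ?_
  convert h using 2 with i
  change -(Witt.L k i (AddMonoidAlgebra.single 1 1)) = _
  rw [Witt.L_single]
  simp

variable [CharZero k]

/-- The basis `2 L_i`, `i ≥ 0`, of the non-negative part of the Witt algebra. -/
def wittBasis : Module.Basis ℕ k (WittNonneg k) :=
  (Module.Basis.span (linearIndependent_L k)).isUnitSMul
    (w := fun _ => (2 : k)) (fun _ => two_ne_zero.isUnit)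

theorem coe_wittBasis (i : ℕ) : (wittBasis k i : Witt k) = (2 : k) • Witt.L k i := by
  have h := Module.Basis.isUnitSMul_apply (v := Module.Basis.span (linearIndependent_L k))
    (w := fun _ => (2 : k)) (fun _ => two_ne_zero.isUnit) i
  exact (congrArg Subtype.val h).trans
    (congrArg (fun x : Witt k => (2 : k) • x)
      (congrArg Subtype.val (Module.Basis.span_apply (linearIndependent_L k) i)))

/-- The bijection `2 i + 1 ↦ i` from the odd numbers to the natural numbers. -/
def oddEquiv : {n : ℕ // Odd n} ≃ ℕ where
  toFun n := n.1 / 2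
  invFun i := ⟨2 * i + 1, odd_two_mul_add_one i⟩
  left_inv n := Subtype.ext (Nat.two_mul_div_two_add_one_of_odd n.2)
  right_inv i := by simp; omega

/-- The isomorphism from `HH^{odd}(A)` to the non-negative part of the Witt algebra. -/
def oddToWitt : HHOdd k (LoopAlg k) ≃ₗ[k] WittNonneg k :=
  (oddBasis k).equiv (wittBasis k) oddEquiv

theorem oddToWitt_oddBasis (i : ℕ) :
    oddToWitt k (oddBasis k ⟨2 * i + 1, odd_two_mul_add_one i⟩) = wittBasis k i := by
  rw [oddToWitt, Module.Basis.equiv_apply]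
  congr 1
  exact oddEquiv.right_inv i

/-- For `n = 2i + 1` and `m = 2j + 1` one has `n - m = 2(i - j)` and `n + m - 1 = 2(i + j) + 1`,
which matches `[2L_i, 2L_j] = 2(i - j) · 2L_(i+j)`. -/
theorem oddToWitt_oddBracket (x y : HHOdd k (LoopAlg k)) :
    oddToWitt k (oddBracket k x y) = ⁅oddToWitt k x, oddToWitt k y⁆ := by
  refine map_eq_lie_of_basis (oddBasis k) (oddBracket k) (oddToWitt k).toLinearMap
    (fun n m => ?_) x y
  obtain ⟨i, rfl⟩ := oddEquiv.symm.surjective n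
  obtain ⟨j, rfl⟩ := oddEquiv.symm.surjective m
  change oddToWitt k (oddBracket k (oddBasis k ⟨2 * i + 1, odd_two_mul_add_one i⟩)
    (oddBasis k ⟨2 * j + 1, odd_two_mul_add_one j⟩)) =
    ⁅oddToWitt k (oddBasis k ⟨2 * i + 1, odd_two_mul_add_one i⟩),
      oddToWitt k (oddBasis k ⟨2 * j + 1, odd_two_mul_add_one j⟩)⁆
  rw [oddBracket_oddBasis k _ _ (odd_two_mul_add_one (i + j)) (by ring), map_smul,
    oddToWitt_oddBasis, oddToWitt_oddBasis, oddToWitt_oddBasis]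
  apply Subtype.ext
  rw [LieSubalgebra.coe_bracket]
  change _ • (wittBasis k (i + j) : Witt k) = _
  rw [coe_wittBasis, coe_wittBasis, coe_wittBasis,
    smul_lie (R := k) (L := Witt k) (M := Witt k), lie_smul (R := k) (L := Witt k) (M := Witt k),
    Witt.L_bracket, smul_smul, smul_smul, smul_smul]
  push_cast
  congr 1
  ring

end Witt
end Hochschild

end

theorem mainTheorem6 (k : Type*) [Field k] [CharZero k] :
    ∃ B : Hochschild.HHOdd k (Hochschild.LoopAlg k) →ₗ[k]
        Hochschild.HHOdd k (Hochschild.LoopAlg k) →ₗ[k]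
          Hochschild.HHOdd k (Hochschild.LoopAlg k),
      -- `B` is the well-defined bracket induced by the Gerstenhaber bracket, and a Lie bracket
      Hochschild.IsInducedBracket B ∧
      (∀ x, B x x = 0) ∧
      (∀ x y z, B x (B y z) + B y (B z x) + B z (B x y) = 0) ∧
      -- the classes of the cocycles `(a^n, a)`, `n` odd, form a basis, with the stated brackets
      ∃ (hc : ∀ n : ℕ, Odd n →
            Hochschild.loopCochain k n ∈ Hochschild.cocycles k (Hochschild.LoopAlg k) n)
        (b : Module.Basis {n : ℕ // Odd n} k (Hochschild.HHOdd k (Hochschild.LoopAlg k))),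
        (∀ (n : ℕ) (hn : Odd n), b ⟨n, hn⟩ = Hochschild.oddClass hn ⟨_, hc n hn⟩) ∧
        (∀ (n m N : ℕ) (hn : Odd n) (hm : Odd m) (hN : Odd N), N + 1 = n + m →
          B (b ⟨n, hn⟩) (b ⟨m, hm⟩) = ((n : k) - (m : k)) • b ⟨N, hN⟩) ∧
        -- identification with the span of the `L_i`, `i ≥ 0`, in the Witt algebra
        ∃ φ : Hochschild.HHOdd k (Hochschild.LoopAlg k) ≃ₗ[k] Hochschild.WittNonneg k,
          (∀ x y, φ (B x y) = ⁅φ x, φ y⁆) ∧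
          (∀ i : ℕ, (φ (b ⟨2 * i + 1, odd_two_mul_add_one i⟩) : Hochschild.Witt k) =
            (2 : k) • Hochschild.Witt.L k i) := by
  have hφ := Hochschild.oddToWitt_oddBracket k
  refine ⟨Hochschild.oddBracket k, Hochschild.isInducedBracket_oddBracket k, fun x => ?_,
    fun x y z => ?_, fun n _ => Hochschild.loopCochain_mem_cocycles k, Hochschild.oddBasis k,
    fun n hn => Hochschild.oddBasis_apply k hn,
    fun n m N hn hm hN h => Hochschild.oddBracket_oddBasis k hn hm hN h,
    Hochschild.oddToWitt k, hφ, fun i => ?_⟩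
  -- The Lie identities hold in the Witt algebra and are reflected by the injective map `oddToWitt`.
  · apply (Hochschild.oddToWitt k).injective
    rw [hφ, lie_self, map_zero]
  · apply (Hochschild.oddToWitt k).injective
    simp only [map_add, hφ, map_zero]
    exact lie_jacobi _ _ _
  · rw [Hochschild.oddToWitt_oddBasis, Hochschild.coe_wittBasis]
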